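/- Let $U\subset\mathbb R^m$ be compact, let $G,G_1\subseteq\mathbb R^n$ be open connected sets with $0\in G$ and $\bar G\subseteq G_1$, and let $f\colon G_1\times U\to\mathbb R^n$ be continuous. A control is a function $u(\cdot)\in\mathcal U=L^\infty_{\rm loc}([0,\infty),U)$; $x(\cdot\,;x_0,u(\cdot))$ denotes the (Carathéodory) solution in $G_1$ of $\dot x=f(x,u(t))$, $x(0)=x_0$. A function is of class $\mathcal K$ if it is a strictly increasing continuous function $[0,\infty)\to[0,\infty)$ vanishing at $0$, of class $\mathcal K_\infty$ if in addition it tends to $+\infty$ at $+\infty$, and of class $\mathcal L$ if it is a nonincreasing continuous function $[0,\infty)\to[0,\infty)$ tending to $0$ at $+\infty$; $\mathcal{KL}$ is the class of continuous $\beta\colon[0,\infty)^2\to[0,\infty)$ with $\beta(\cdot,t)\in\mathcal K$ and $\beta(\rho,\cdot)\in\mathcal L$ for all $\rho,t\ge 0$. $B_\rho(0)$ and $\bar B_\rho(0)$ are the open and closed Euclidean balls. Assume: (A) (i) for all $u(\cdot)\in\mathcal U$, $x_0\in G$ and $T\in(0,+\infty]$, every solution on $[0,T)$ starting at $x_0$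 stays in $G$; (ii) for every $R>0$ there is $C_{1,R}>0$ with $\|f(x,u)-f(x',u)\|\le C_{1,R}\|x-x'\|$ for $x,x'\in\bar B_R(0)\cap\bar G$, $u\in U$; (iii) there are a $C^1$ function $Y\colon G_1\to[0,\infty)$ such that the preimage of every compact set is compact, and $C_2>0$, with $\langle \mathrm DY(x),f(x,u)\rangle\le C_2Y(x)$ for all $x\in G_1$, $u\in U$. (B) $0\in U$ and $f(0,0)=0$, and there are $r>0$, $\bar u>0$, $\beta\in\mathcal{KL}$ and $\alpha_1,\alpha_2\in\mathcal K_\infty$ with $\bar B_r(0)\subset G$ and $\beta(\rho,t)\le\alpha_2(\alpha_1(\rho)e^{-t})$ for all $\rho,t\ge0$, and constants $C_{11},C_{12}>0$, such that one of the following holds: (B1) for every $x_0\in B_r(0)$ there is $u(\cdot)\in\mathcal U$ with $\|u\|_{L^\infty}\le\bar u$ and $\|x(t;x_0,u(\cdot))\|\le\beta(\|x_0\|,t)$ for all $t\ge0$; and $g(x,u)\le C_{11}(\alpha_2^{-1}(\|x\|))^{C_{12}}$ for $x\in\bar B_r(0)$, $u\in\bar B_{\bar u}(0)\cap U$; (B2)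 $\bar u=\beta(r,0)$, for every $x_0\in B_r(0)$ there is $u(\cdot)\in\mathcal U$ with $\|x(t;x_0,u(\cdot))\|+\|u(t)\|\le\beta(\|x_0\|,t)$ for all $t\ge0$; and $g(x,u)\le C_{11}(\alpha_2^{-1}(\|x\|+\|u\|))^{C_{12}}$ for $x\in\bar B_r(0)$, $u\in\bar B_{\bar u}(0)\cap U$. (C) $g\colon\bar G\times U\to[0,\infty)$ is continuous; for every $R>0$ there is $C_{5,R}>0$ with $|g(x,u)-g(x',u)|\le C_{5,R}\|x-x'\|$ for $x,x'\in\bar B_R(0)\cap\bar G$, $u\in U$; for every $R>0$, $\inf\{g(x,u):(x,u)\in\bar G\times U,\ \|x\|\ge R\}>0$ (where $\inf\emptyset=+\infty$); and there is $C_{13}>0$ with $g(x,u)\ge C_{13}\|f(x,u)\|$ for all $(x,u)\in\bar G\times U$ with $\|x\|\ge2r$ or $\|u\|\ge2\bar u$. (D) For every $x\in\bar G$ the set $\{(f(x,u),y)\in\mathbb R^n\times\mathbb R: u\in U,\ y\ge g(x,u)\}$ is convex. Let $\mathcal D_0$ be the set of $x_0\in G$ for which some $u(\cdot)\in\mathcal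 U$ satisfies $\lim_{t\to\infty}\|x(t;x_0,u(\cdot))\|=0$. Let $\delta\in(0,r]$ and $x_0\in\mathcal D_0\setminus\bar B_\delta(0)$, and put $T_\delta(x_0,u(\cdot))=\inf\{T\ge0: x(T;x_0,u(\cdot))\in\bar B_\delta(0)\}$ (with $\inf\emptyset=+\infty$). Then the two exit-time problems $$V_\delta(x_0)=\inf\Big\{\int_0^T g(x(t;x_0,u(\cdot)),u(t))\,dt:\ u(\cdot)\in\mathcal U,\ T\ge0,\ x(T;x_0,u(\cdot))\in\bar B_\delta(0)\Big\}$$ and $$\inf\Big\{\int_0^{T_\delta(x_0,u(\cdot))} g(x(t;x_0,u(\cdot)),u(t))\,dt:\ u(\cdot)\in\mathcal U,\ T_\delta(x_0,u(\cdot))<+\infty\Big\}$$ have the same finite value, and there exists a control $u^*(\cdot)\in\mathcal U$ that is optimal (attains the infimum) in both. -/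

import Mathlib

open MeasureTheory Set Filter Topology
open scoped NNReal ENNReal

noncomputable section

/-- Class `K`: strictly increasing continuous functions on `[0, ∞)` vanishing at `0`. -/
structure IsClassK (φ : ℝ≥0 → ℝ≥0) : Prop where
  strictMono : StrictMono φ
  continuous : Continuous φ
  map_zero : φ 0 = 0

/-- Class `K_∞`: functions of class `K` tending to `+∞` at `+∞`. -/
structure IsClassKInfty (φ : ℝ≥0 → ℝ≥0) : Prop extends IsClassK φ where
  tendsto_atTop : Tendsto φ atTop atTop

/-- Class `L`: nonincreasing continuous functions on `[0, ∞)` tending to `0` at `+∞`. -/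
structure IsClassL (φ : ℝ≥0 → ℝ≥0) : Prop where
  antitone : Antitone φ
  continuous : Continuous φ
  tendsto_zero : Tendsto φ atTop (𝓝 0)

/-- Class `KL`: jointly continuous, of class `K` in the first and of class `L` in the second
argument. -/
structure IsClassKL (β : ℝ≥0 → ℝ≥0 → ℝ≥0) : Prop where
  continuous : Continuous (Function.uncurry β)
  left : ∀ t, IsClassK (fun ρ => β ρ t)
  right : ∀ ρ, IsClassL (fun t => β ρ t)

variable {n m : ℕ}

/-- Control strategies: locally essentially bounded (Lebesgue measurable) functions
`[0, ∞) → U`; the values at negative times are irrelevant. -/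
structure IsControl (U : Set (EuclideanSpace ℝ (Fin m))) (u : ℝ → EuclideanSpace ℝ (Fin m)) :
    Prop where
  mem : ∀ t, 0 ≤ t → u t ∈ U
  locallyBounded : ∀ T : ℝ, MemLp u ∞ (volume.restrict (Icc 0 T))

/-- `x` is a Carathéodory solution, on the time interval `I` with left endpoint `0 ∈ I`, of
`x' = f (x, u)`, `x 0 = x₀`, with values in the domain `G₁` of `f (·, u)`.  Being absolutely
continuous with the equation satisfied almost everywhere is written in the integral form. -/
structure IsTrajectory (G₁ : Set (EuclideanSpace ℝ (Fin n)))
    (f : EuclideanSpace ℝ (Fin n) → EuclideanSpace ℝ (Fin m) → EuclideanSpace ℝ (Fin n))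
    (x₀ : EuclideanSpace ℝ (Fin n)) (u : ℝ → EuclideanSpace ℝ (Fin m)) (I : Set ℝ)
    (x : ℝ → EuclideanSpace ℝ (Fin n)) : Prop where
  mem : ∀ t ∈ I, x t ∈ G₁
  continuousOn : ContinuousOn x I
  integrable : ∀ t ∈ I, IntervalIntegrable (fun s => f (x s) (u s)) volume 0 t
  eq_integral : ∀ t ∈ I, x t = x₀ + ∫ s in (0 : ℝ)..t, f (x s) (u s)

/-- The standing assumptions on the control system. -/
structure SystemAssumption (U : Set (EuclideanSpace ℝ (Fin m)))
    (G G₁ : Set (EuclideanSpace ℝ (Fin n)))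
    (f : EuclideanSpace ℝ (Fin n) → EuclideanSpace ℝ (Fin m) → EuclideanSpace ℝ (Fin n)) :
    Prop where
  isCompact_U : IsCompact U
  isOpen_G : IsOpen G
  isConnected_G : IsConnected G
  isOpen_G₁ : IsOpen G₁
  isConnected_G₁ : IsConnected G₁
  closure_subset : closure G ⊆ G₁
  zero_mem : 0 ∈ G
  continuousOn_f : ContinuousOn (Function.uncurry f) (G₁ ×ˢ U)
  /-- Strong invariance of `G`: every trajectory on `[0, T)`, `0 < T ≤ +∞`, that starts in `G`
  stays in `G` (which is open, hence disjoint from its boundary). -/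
  invariant : ∀ x₀ ∈ G, ∀ u, IsControl U u → ∀ T : EReal, 0 < T → ∀ x,
    IsTrajectory G₁ f x₀ u {t : ℝ | 0 ≤ t ∧ (t : EReal) < T} x →
      ∀ t : ℝ, 0 ≤ t → (t : EReal) < T → x t ∈ G
  lipschitz : ∀ R : ℝ, 0 < R → ∃ C : ℝ, 0 < C ∧
    ∀ x ∈ Metric.closedBall 0 R ∩ closure G, ∀ x' ∈ Metric.closedBall 0 R ∩ closure G,
      ∀ u ∈ U, ‖f x u - f x' u‖ ≤ C * ‖x - x'‖
  /-- The preimages `G₁ ∩ Y ⁻¹' K` of compact sets `K` being compact says that the function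
  `Y : G₁ → [0, ∞)` is proper. -/
  growth : ∃ Y : EuclideanSpace ℝ (Fin n) → ℝ, ∃ C : ℝ, 0 < C ∧
    (∀ x ∈ G₁, 0 ≤ Y x) ∧ ContDiffOn ℝ 1 Y G₁ ∧
    (∀ K : Set ℝ, IsCompact K → IsCompact (G₁ ∩ Y ⁻¹' K)) ∧
    ∀ x ∈ G₁, ∀ u ∈ U, fderiv ℝ Y x (f x u) ≤ C * Y x

/-- The region of asymptotic null-controllability. -/
def nullControllableRegion (U : Set (EuclideanSpace ℝ (Fin m)))
    (G G₁ : Set (EuclideanSpace ℝ (Fin n)))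
    (f : EuclideanSpace ℝ (Fin n) → EuclideanSpace ℝ (Fin m) → EuclideanSpace ℝ (Fin n)) :
    Set (EuclideanSpace ℝ (Fin n)) :=
  {x₀ | x₀ ∈ G ∧ ∃ u, IsControl U u ∧ ∃ x, IsTrajectory G₁ f x₀ u (Ici 0) x ∧
    Tendsto (fun t => ‖x t‖) atTop (𝓝 0)}

/-- Local asymptotic null-controllability with controls bounded by `ubar`. -/
structure LocallyNullControllable (U : Set (EuclideanSpace ℝ (Fin m)))
    (G G₁ : Set (EuclideanSpace ℝ (Fin n)))
    (f : EuclideanSpace ℝ (Fin n) → EuclideanSpace ℝ (Fin m) → EuclideanSpace ℝ (Fin n))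
    (r ubar : ℝ≥0) (β : ℝ≥0 → ℝ≥0 → ℝ≥0) : Prop where
  zero_mem : 0 ∈ U
  equilibrium : f 0 0 = 0
  r_pos : 0 < r
  ubar_pos : 0 < ubar
  classKL : IsClassKL β
  closedBall_subset : Metric.closedBall 0 (r : ℝ) ⊆ G
  exists_control : ∀ x₀ ∈ Metric.ball (0 : EuclideanSpace ℝ (Fin n)) (r : ℝ),
    ∃ u, IsControl U u ∧ eLpNorm u ∞ (volume.restrict (Ici 0)) ≤ (ubar : ℝ≥0∞) ∧
      ∃ x, IsTrajectory G₁ f x₀ u (Ici 0) x ∧ ∀ t : ℝ≥0, ‖x t‖₊ ≤ β ‖x₀‖₊ t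

/-- The small control property. -/
structure SmallControlProperty (U : Set (EuclideanSpace ℝ (Fin m)))
    (G G₁ : Set (EuclideanSpace ℝ (Fin n)))
    (f : EuclideanSpace ℝ (Fin n) → EuclideanSpace ℝ (Fin m) → EuclideanSpace ℝ (Fin n))
    (r : ℝ≥0) (β : ℝ≥0 → ℝ≥0 → ℝ≥0) : Prop where
  zero_mem : 0 ∈ U
  equilibrium : f 0 0 = 0
  r_pos : 0 < r
  classKL : IsClassKL β
  closedBall_subset : Metric.closedBall 0 (r : ℝ) ⊆ G
  exists_control : ∀ x₀ ∈ Metric.ball (0 : EuclideanSpace ℝ (Fin n)) (r : ℝ),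
    ∃ u, IsControl U u ∧
      ∃ x, IsTrajectory G₁ f x₀ u (Ici 0) x ∧ ∀ t : ℝ≥0, ‖x t‖₊ + ‖u t‖₊ ≤ β ‖x₀‖₊ t

/-- Conditions on the running cost common to both controllability settings. -/
structure RunningCostAssumption (U : Set (EuclideanSpace ℝ (Fin m)))
    (G : Set (EuclideanSpace ℝ (Fin n)))
    (f : EuclideanSpace ℝ (Fin n) → EuclideanSpace ℝ (Fin m) → EuclideanSpace ℝ (Fin n))
    (g : EuclideanSpace ℝ (Fin n) → EuclideanSpace ℝ (Fin m) → ℝ) (r ubar : ℝ≥0) : Prop where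
  nonneg : ∀ x ∈ closure G, ∀ u ∈ U, 0 ≤ g x u
  continuousOn_g : ContinuousOn (Function.uncurry g) (closure G ×ˢ U)
  lipschitz : ∀ R : ℝ, 0 < R → ∃ C : ℝ, 0 < C ∧
    ∀ x ∈ Metric.closedBall 0 R ∩ closure G, ∀ x' ∈ Metric.closedBall 0 R ∩ closure G,
      ∀ u ∈ U, |g x u - g x' u| ≤ C * ‖x - x'‖
  /-- The infimum of `g` over `‖x‖ ≥ R` is positive (with `inf ∅ = +∞`). -/
  pos_away : ∀ R : ℝ, 0 < R → ∃ c : ℝ, 0 < c ∧ ∀ x ∈ closure G, ∀ u ∈ U, R ≤ ‖x‖ → c ≤ g x u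
  growth : ∃ C : ℝ, 0 < C ∧ ∀ x ∈ closure G, ∀ u ∈ U,
    (2 * (r : ℝ) ≤ ‖x‖ ∨ 2 * (ubar : ℝ) ≤ ‖u‖) → C * ‖f x u‖ ≤ g x u

/-- Upper bound of the running cost near the origin in terms of `α₂⁻¹ (‖x‖)`; a function `α₂` of
class `K_∞` is a bijection of `[0, ∞)`, so `Function.invFun α₂` is its inverse. -/
def CostBoundState (U : Set (EuclideanSpace ℝ (Fin m)))
    (g : EuclideanSpace ℝ (Fin n) → EuclideanSpace ℝ (Fin m) → ℝ) (r ubar : ℝ≥0)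
    (α₂ : ℝ≥0 → ℝ≥0) : Prop :=
  ∃ C p : ℝ, 0 < C ∧ 0 < p ∧ ∀ x ∈ Metric.closedBall 0 (r : ℝ),
    ∀ u ∈ Metric.closedBall 0 (ubar : ℝ) ∩ U,
      g x u ≤ C * ((Function.invFun α₂ ‖x‖₊ : ℝ≥0) : ℝ) ^ p

/-- Upper bound of the running cost near the origin in terms of `α₂⁻¹ (‖x‖ + ‖u‖)`. -/
def CostBoundStateControl (U : Set (EuclideanSpace ℝ (Fin m)))
    (g : EuclideanSpace ℝ (Fin n) → EuclideanSpace ℝ (Fin m) → ℝ) (r ubar : ℝ≥0)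
    (α₂ : ℝ≥0 → ℝ≥0) : Prop :=
  ∃ C p : ℝ, 0 < C ∧ 0 < p ∧ ∀ x ∈ Metric.closedBall 0 (r : ℝ),
    ∀ u ∈ Metric.closedBall 0 (ubar : ℝ) ∩ U,
      g x u ≤ C * ((Function.invFun α₂ (‖x‖₊ + ‖u‖₊) : ℝ≥0) : ℝ) ^ p

/-- The cost `∫₀ᵀ g (x t, u t) dt ∈ [0, +∞]` (for a nonnegative running cost). -/
def runningCost (g : EuclideanSpace ℝ (Fin n) → EuclideanSpace ℝ (Fin m) → ℝ)
    (x : ℝ → EuclideanSpace ℝ (Fin n)) (u : ℝ → EuclideanSpace ℝ (Fin m)) (T : ℝ) : ℝ≥0∞ :=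
  ∫⁻ t in Icc 0 T, ENNReal.ofReal (g (x t) (u t))

/-- The trajectory `x` of the control `u` from `x₀`, followed on `[0, T]`, ends in the closed ball
of radius `δ` about the origin. -/
def Reaches (G₁ : Set (EuclideanSpace ℝ (Fin n)))
    (f : EuclideanSpace ℝ (Fin n) → EuclideanSpace ℝ (Fin m) → EuclideanSpace ℝ (Fin n))
    (δ : ℝ) (x₀ : EuclideanSpace ℝ (Fin n)) (u : ℝ → EuclideanSpace ℝ (Fin m)) (T : ℝ≥0)
    (x : ℝ → EuclideanSpace ℝ (Fin n)) : Prop :=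
  IsTrajectory G₁ f x₀ u (Icc 0 (T : ℝ)) x ∧ x T ∈ Metric.closedBall 0 δ

/-- The value of the problem in which both the control and the terminal time are chosen, subject
to the trajectory being in the target ball at the terminal time (`+∞` if this is impossible). -/
def freeTimeValue (U : Set (EuclideanSpace ℝ (Fin m))) (G₁ : Set (EuclideanSpace ℝ (Fin n)))
    (f : EuclideanSpace ℝ (Fin n) → EuclideanSpace ℝ (Fin m) → EuclideanSpace ℝ (Fin n))
    (g : EuclideanSpace ℝ (Fin n) → EuclideanSpace ℝ (Fin m) → ℝ)
    (δ : ℝ) (x₀ : EuclideanSpace ℝ (Fin n)) : ℝ≥0∞ :=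
  sInf {J | ∃ u, IsControl U u ∧ ∃ T x, Reaches G₁ f δ x₀ u T x ∧ J = runningCost g x u T}

/-- The first time at which the control `u` brings `x₀` to the target ball (`+∞` if it never
does). -/
def exitTime (G₁ : Set (EuclideanSpace ℝ (Fin n)))
    (f : EuclideanSpace ℝ (Fin n) → EuclideanSpace ℝ (Fin m) → EuclideanSpace ℝ (Fin n))
    (δ : ℝ) (x₀ : EuclideanSpace ℝ (Fin n)) (u : ℝ → EuclideanSpace ℝ (Fin m)) : ℝ≥0∞ :=
  sInf {τ | ∃ T : ℝ≥0, ∃ x, Reaches G₁ f δ x₀ u T x ∧ τ = (T : ℝ≥0∞)}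

/-- The value of the problem in which only the control is chosen and the cost is accumulated up
to the exit time, which has to be finite. -/
def exitTimeValue (U : Set (EuclideanSpace ℝ (Fin m))) (G₁ : Set (EuclideanSpace ℝ (Fin n)))
    (f : EuclideanSpace ℝ (Fin n) → EuclideanSpace ℝ (Fin m) → EuclideanSpace ℝ (Fin n))
    (g : EuclideanSpace ℝ (Fin n) → EuclideanSpace ℝ (Fin m) → ℝ)
    (δ : ℝ) (x₀ : EuclideanSpace ℝ (Fin n)) : ℝ≥0∞ :=
  sInf {J | ∃ u, IsControl U u ∧ exitTime G₁ f δ x₀ u < ∞ ∧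
    ∃ x, IsTrajectory G₁ f x₀ u (Icc 0 (exitTime G₁ f δ x₀ u).toReal) x ∧
      J = runningCost g x u (exitTime G₁ f δ x₀ u).toReal}

/-- `u` is an optimal control in the problem with free terminal time. -/
def IsFreeTimeOptimal (U : Set (EuclideanSpace ℝ (Fin m))) (G₁ : Set (EuclideanSpace ℝ (Fin n)))
    (f : EuclideanSpace ℝ (Fin n) → EuclideanSpace ℝ (Fin m) → EuclideanSpace ℝ (Fin n))
    (g : EuclideanSpace ℝ (Fin n) → EuclideanSpace ℝ (Fin m) → ℝ)
    (δ : ℝ) (x₀ : EuclideanSpace ℝ (Fin n)) (u : ℝ → EuclideanSpace ℝ (Fin m)) : Prop :=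
  IsControl U u ∧ ∃ T x, Reaches G₁ f δ x₀ u T x ∧
    runningCost g x u T = freeTimeValue U G₁ f g δ x₀

/-- `u` is an optimal control in the problem with the cost accumulated up to the exit time. -/
def IsExitTimeOptimal (U : Set (EuclideanSpace ℝ (Fin m))) (G₁ : Set (EuclideanSpace ℝ (Fin n)))
    (f : EuclideanSpace ℝ (Fin n) → EuclideanSpace ℝ (Fin m) → EuclideanSpace ℝ (Fin n))
    (g : EuclideanSpace ℝ (Fin n) → EuclideanSpace ℝ (Fin m) → ℝ)
    (δ : ℝ) (x₀ : EuclideanSpace ℝ (Fin n)) (u : ℝ → EuclideanSpace ℝ (Fin m)) : Prop :=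
  IsControl U u ∧ exitTime G₁ f δ x₀ u < ∞ ∧
    ∃ x, IsTrajectory G₁ f x₀ u (Icc 0 (exitTime G₁ f δ x₀ u).toReal) x ∧
      runningCost g x u (exitTime G₁ f δ x₀ u).toReal = exitTimeValue U G₁ f g δ x₀

end

/-! The direct method.  Take a minimizing sequence of controls and cut each of its trajectories
off at the first visit to the target.  Until then the running cost is at least some `c > 0`, so the
terminal times are bounded; far out the cost dominates the speed, so the states stay in a fixed
compact set.  The curves (state, accumulated cost) are then uniformly Lipschitz and converge along
an ultrafilter to a Lipschitz curve whose derivative lies in the augmented velocity set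
`{(f (x, u), c) | u ∈ U, g (x, u) ≤ c}`, because this set is closed and convex and depends
semicontinuously on `x`.  Filippov's measurable selection of `u` turns the limit curve into a
trajectory of a control whose cost is at most its last coordinate, the limit of the costs.  Since
trajectories in the invariant set are unique, the first visit of a trajectory to the target is the
exit time of its control, which identifies the two problems. -/

section LipschitzCurves

theorem intervalIntegrable_deriv_of_lipschitzWith {E : Type*} [NormedAddCommGroup E]
    [NormedSpace ℝ E] [FiniteDimensional ℝ E] {K : ℝ≥0} {X : ℝ → E} (hX : LipschitzWith K X)
    (a b : ℝ) : IntervalIntegrable (deriv X) volume a b := by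
  have := FiniteDimensional.complete ℝ E
  have := FiniteDimensional.proper ℝ E
  borelize E
  refine (intervalIntegrable_const (c := (K : ℝ))).mono_fun
    (measurable_deriv X).aestronglyMeasurable (ae_of_all _ fun t => ?_)
  simpa using norm_deriv_le_of_lipschitz hX

theorem integral_deriv_of_lipschitzWith {E : Type*} [NormedAddCommGroup E]
    [NormedSpace ℝ E] [FiniteDimensional ℝ E] {K : ℝ≥0} {X : ℝ → E} (hX : LipschitzWith K X)
    (a b : ℝ) : ∫ t in a..b, deriv X t = X b - X a := by
  have := FiniteDimensional.complete ℝ E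
  refine (SeparatingDual.eq_iff_forall_dual_eq (R := ℝ)).2 fun φ => ?_
  rw [← φ.intervalIntegral_comp_comm (intervalIntegrable_deriv_of_lipschitzWith hX a b), map_sub,
    ← AbsolutelyContinuousOnInterval.integral_deriv_eq_sub (f := fun t => φ (X t))
      (φ.lipschitz.comp hX).lipschitzOnWith.absolutelyContinuousOnInterval]
  refine intervalIntegral.integral_congr_ae ?_
  filter_upwards [hX.ae_differentiableAt_real] with t ht _
  exact ((φ.hasFDerivAt.comp_hasDerivAt t ht.hasDerivAt).deriv).symm

theorem lipschitzWith_add_integral {E : Type*} [NormedAddCommGroup E] [NormedSpace ℝ E]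
    {v : ℝ → E} {B : ℝ≥0} (hint : ∀ a b, IntervalIntegrable v volume a b)
    (hB : ∀ s, ‖v s‖ ≤ B) (w : E) (a : ℝ) : LipschitzWith B fun t => w + ∫ s in a..t, v s := by
  refine LipschitzWith.of_dist_le_mul fun t s => ?_
  rw [dist_add_left, dist_eq_norm, intervalIntegral.integral_interval_sub_left (hint _ _)
    (hint _ _), Real.dist_eq]
  exact intervalIntegral.norm_integral_le_of_norm_le_const fun τ _ => hB τ

theorem exists_tendsto_ultrafilter_of_mem_compact {ι X : Type*} [TopologicalSpace X]
    (l : Ultrafilter ι) {K : Set X} (hK : IsCompact K) {w : ι → X} (hw : ∀ k, w k ∈ K) :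
    ∃ y, Tendsto w l (𝓝 y) := by
  obtain ⟨y, -, hy⟩ := hK.ultrafilter_le_nhds (l.map w)
    (le_principal_iff.2 (Eventually.of_forall (f := (l : Filter ι)) hw))
  exact ⟨y, hy⟩

theorem exists_lipschitzWith_tendsto_ultrafilter {ι X Y : Type*} [PseudoMetricSpace X]
    [PseudoMetricSpace Y] [ProperSpace Y] (l : Ultrafilter ι) {F : ι → X → Y} {K : ℝ≥0}
    (hF : ∀ k, LipschitzWith K (F k)) {a : X} {b : Y} (hb : ∀ k, F k a = b) :
    ∃ φ : X → Y, LipschitzWith K φ ∧ ∀ t, Tendsto (fun k => F k t) l (𝓝 (φ t)) := by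
  have hlim (t : X) : ∃ y, Tendsto (fun k => F k t) l (𝓝 y) :=
    exists_tendsto_ultrafilter_of_mem_compact l (isCompact_closedBall b (K * dist t a)) fun k => by
      simpa only [Metric.mem_closedBall, hb] using (hF k).dist_le_mul t a
  choose φ hφ using hlim
  exact ⟨φ, LipschitzWith.of_dist_le_mul fun t s => le_of_tendsto ((hφ t).dist (hφ s))
    (Eventually.of_forall fun k => (hF k).dist_le_mul t s), hφ⟩

theorem tendsto_uncurry_of_lipschitzWith {ι X Y : Type*} [PseudoMetricSpace X]
    [PseudoMetricSpace Y] {l : Filter ι} {F : ι → X → Y} {K : ℝ≥0}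
    (hF : ∀ k, LipschitzWith K (F k)) {a : X} {b : Y} (hb : Tendsto (fun k => F k a) l (𝓝 b)) :
    Tendsto (fun q : ι × X => F q.1 q.2) (l ×ˢ 𝓝 a) (𝓝 b) := by
  have hle (q : ι × X) : dist (F q.1 q.2) b ≤ K * dist q.2 a + dist (F q.1 a) b :=
    (dist_triangle _ (F q.1 a) _).trans (by gcongr; exact (hF q.1).dist_le_mul _ _)
  have hX : Tendsto (fun q : ι × X => K * dist q.2 a) (l ×ˢ 𝓝 a) (𝓝 0) := by
    simpa using ((tendsto_snd (f := l) (g := 𝓝 a)).dist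
      (tendsto_const_nhds (x := a))).const_mul (K : ℝ)
  have hY : Tendsto (fun q : ι × X => dist (F q.1 a) b) (l ×ˢ 𝓝 a) (𝓝 0) :=
    (tendsto_iff_dist_tendsto_zero.1 hb).comp tendsto_fst
  exact tendsto_iff_dist_tendsto_zero.2
    (squeeze_zero (fun _ => dist_nonneg) hle (by simpa using hX.add hY))

theorem slope_mem_of_convex {E : Type*} [NormedAddCommGroup E] [NormedSpace ℝ E] [CompleteSpace E]
    {C : Set E} (hC : Convex ℝ C) (hcl : IsClosed C) {v X : ℝ → E} {a b : ℝ} (hab : a < b)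
    (hv : IntervalIntegrable v volume a b) (hX : X b - X a = ∫ s in a..b, v s)
    (hmem : ∀ s ∈ Ioc a b, v s ∈ C) : slope X a b ∈ C := by
  have hmean := hC.set_average_mem (μ := volume) (t := Ioc a b) (f := v) hcl (by simp [hab])
    (by simp) ((ae_restrict_iff' measurableSet_Ioc).2 (ae_of_all _ hmem))
    ((intervalIntegrable_iff_integrableOn_Ioc_of_le hab.le).1 hv)
  rw [setAverage_eq, ← intervalIntegral.integral_of_le hab.le, ← hX] at hmean
  simpa [slope_def_module, Measure.real, hab.le] using hmean

theorem hasDerivAt_mem_of_tendsto_integral {ι E : Type*} [NormedAddCommGroup E] [NormedSpace ℝ E]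
    [CompleteSpace E] {l : Filter ι} [l.NeBot] {C : Set E} (hC : Convex ℝ C) (hcl : IsClosed C)
    {v X : ι → ℝ → E} {Y : ℝ → E} {t : ℝ} {p : E}
    (hv : ∀ k a b, IntervalIntegrable (v k) volume a b)
    (hX : ∀ k a b, X k b - X k a = ∫ s in a..b, v k s)
    (hlim : ∀ s, Tendsto (fun k => X k s) l (𝓝 (Y s))) (hder : HasDerivAt Y p t)
    (hnear : ∀ ε > 0, ∀ᶠ q in l ×ˢ 𝓝[>] t, v q.1 q.2 ∈ Metric.cthickening ε C) : p ∈ C := by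
  rw [← hcl.closure_eq, Metric.closure_eq_iInter_cthickening]
  refine mem_iInter₂.2 fun ε hε => ?_
  obtain ⟨P, hP, Q, hQ, hPQ⟩ := eventually_prod_iff.1 (hnear ε hε)
  obtain ⟨b, htb, hb⟩ := mem_nhdsGT_iff_exists_Ioc_subset.1 hQ
  have hslope : ∀ h ∈ Ioc t b, slope Y t h ∈ Metric.cthickening ε C := fun h hh =>
    Metric.isClosed_cthickening.mem_of_tendsto
      (((hlim h).sub (hlim t)).const_smul (h - t)⁻¹) <| hP.mono fun k hk =>
        slope_mem_of_convex (hC.cthickening ε) Metric.isClosed_cthickening hh.1 (hv k t h)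
          (hX k t h) fun s hs => hPQ hk (hb ⟨hs.1, hs.2.trans hh.2⟩)
  exact Metric.isClosed_cthickening.mem_of_tendsto
    ((hasDerivAt_iff_tendsto_slope.1 hder).mono_left (nhdsGT_le_nhdsNE t))
    (eventually_of_mem (Ioc_mem_nhdsGT htb) hslope)

theorem eqOn_zero_of_le_mul_integral {φ : ℝ → ℝ} {C a b : ℝ} (hφ : ContinuousOn φ (Icc a b))
    (h0 : ∀ t ∈ Icc a b, 0 ≤ φ t) (hle : ∀ t ∈ Icc a b, φ t ≤ C * ∫ s in a..t, φ s) :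
    EqOn φ 0 (Icc a b) := by
  rcases lt_or_ge b a with hab | hab
  · simp [Icc_eq_empty hab.not_ge]
  have hint : ∀ t ∈ Icc a b, IntervalIntegrable φ volume a t := fun t ht =>
    (hφ.mono (Icc_subset_Icc_right ht.2)).intervalIntegrable_of_Icc ht.1
  have hcont : ContinuousOn (fun t => ∫ s in a..t, φ s) (Icc a b) := by
    rw [← uIcc_of_le hab] at hφ ⊢
    exact intervalIntegral.continuousOn_primitive_interval (hφ.integrableOn_compact isCompact_uIcc)
  have hderiv : ∀ t ∈ Ico a b, HasDerivWithinAt (fun t => ∫ s in a..t, φ s) (φ t) (Ici t) t := by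
    intro t ht
    have hnhds : 𝓝[>] t ≤ 𝓝[Icc a b] t := nhdsWithin_le_of_mem (Icc_mem_nhdsGT_of_mem ht)
    exact intervalIntegral.integral_hasDerivWithinAt_right (hint t (Ico_subset_Icc_self ht))
      ((hφ.stronglyMeasurableAtFilter_nhdsWithin measurableSet_Icc t).filter_mono hnhds)
      ((hφ t (Ico_subset_Icc_self ht)).mono_left hnhds)
  have hzero := eq_zero_of_abs_deriv_le_mul_abs_self_of_eq_zero_right (K := C) hcont hderiv
    (by simp) fun t ht => by
      have hnn : 0 ≤ ∫ s in a..t, φ s := intervalIntegral.integral_nonneg ht.1 fun s hs =>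
        h0 s ⟨hs.1, hs.2.trans ht.2.le⟩
      rw [Real.norm_of_nonneg hnn, Real.norm_of_nonneg (h0 t (Ico_subset_Icc_self ht))]
      exact hle t (Ico_subset_Icc_self ht)
  exact fun t ht => le_antisymm (by simpa [hzero t ht] using hle t ht) (h0 t ht)

end LipschitzCurves

section MeasurableSelection

variable {α Y : Type*} [MeasurableSpace α]

theorem measurable_iInf_of_continuous [TopologicalSpace Y] [TopologicalSpace.SeparableSpace Y]
    {φ : α → Y → ℝ} (hmeas : ∀ y, Measurable fun a => φ a y) (hcont : ∀ a, Continuous (φ a)) :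
    Measurable fun a => ⨅ y, φ a y := by
  obtain ⟨D, hDc, hD⟩ := TopologicalSpace.exists_countable_dense Y
  have : Countable D := hDc.to_subtype
  simpa only [hD.ciInf' (hcont _)] using Measurable.iInf fun d : D => hmeas d

theorem measurable_of_isLeast_setOf_isMinOn {Z : Set ℝ} (hZ : IsCompact Z) {φ : α → Z → ℝ}
    (hmeas : ∀ z, Measurable fun a => φ a z) (hcont : ∀ a, Continuous (φ a)) {ζ : α → Z}
    (hζ : ∀ a, IsLeast {z | IsMinOn (φ a) univ z} (ζ a)) : Measurable ζ := by
  have : CompactSpace Z := isCompact_iff_compactSpace.1 hZ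
  suffices Measurable fun a => (ζ a : ℝ) from this.subtype_mk
  refine measurable_of_Iic fun c => ?_
  rcases isEmpty_or_nonempty {z : Z | (z : ℝ) ≤ c} with hempty | hne
  · convert MeasurableSet.empty
    exact eq_empty_of_forall_notMem fun a ha => hempty.false ⟨ζ a, ha⟩
  have hbdd (a : α) : BddBelow (range (φ a)) := (isCompact_range (hcont a)).bddBelow
  have hiff : (fun a => (ζ a : ℝ)) ⁻¹' Iic c =
      {a | ⨅ z : {z : Z | (z : ℝ) ≤ c}, φ a z.1 ≤ ⨅ z, φ a z} := by
    ext a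
    refine ⟨fun ha => ?_, fun ha => ?_⟩
    · have : Nonempty Z := ⟨ζ a⟩
      exact le_ciInf fun z => (ciInf_le ((hbdd a).mono (range_comp_subset_range Subtype.val (φ a)))
        (⟨ζ a, ha⟩ : {z : Z | (z : ℝ) ≤ c})).trans ((hζ a).1 (mem_univ z))
    · have hclosed : IsClosed {z : Z | (z : ℝ) ≤ c} :=
        isClosed_le continuous_subtype_val continuous_const
      obtain ⟨z, hzc, hz⟩ := hclosed.isCompact.exists_isMinOn (nonempty_coe_sort.1 hne)
        (hcont a).continuousOn
      refine le_trans (show (ζ a : ℝ) ≤ z from (hζ a).2 fun w _ => ?_) hzc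
      calc φ a z ≤ ⨅ z : {z : Z | (z : ℝ) ≤ c}, φ a z.1 := le_ciInf fun y => hz y.2
        _ ≤ ⨅ z, φ a z := ha
        _ ≤ φ a w := ciInf_le (hbdd a) w
  rw [hiff]
  exact measurableSet_le (measurable_iInf_of_continuous (fun z => hmeas z) fun a =>
    (hcont a).comp continuous_subtype_val) (measurable_iInf_of_continuous hmeas hcont)

theorem exists_measurable_isMinOn_of_subset_real {Z : Set ℝ} (hZ : IsCompact Z)
    (hne : Z.Nonempty) {φ : α → Z → ℝ} (hmeas : ∀ z, Measurable fun a => φ a z)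
    (hcont : ∀ a, Continuous (φ a)) :
    ∃ ζ : α → Z, Measurable ζ ∧ ∀ a, IsMinOn (φ a) univ (ζ a) := by
  have : CompactSpace Z := isCompact_iff_compactSpace.1 hZ
  have : Nonempty Z := hne.to_subtype
  have hleast (a : α) : ∃ z, IsLeast {z | IsMinOn (φ a) univ z} z := by
    have hclosed : IsClosed {z | IsMinOn (φ a) univ z} := by
      simp only [isMinOn_univ_iff, ofPred_forall]
      exact isClosed_iInter fun w => isClosed_le (hcont a) continuous_const
    obtain ⟨z, -, hz⟩ := isCompact_univ.exists_isMinOn univ_nonempty (hcont a).continuousOn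
    exact hclosed.isCompact.exists_isLeast ⟨z, hz⟩
  choose ζ hζ using hleast
  exact ⟨ζ, measurable_of_isLeast_setOf_isMinOn hZ hmeas hcont hζ, fun a => (hζ a).1⟩

/- A compact metric space is a continuous image of the Cantor set, and among the points of the
Cantor set sent to a minimizer there is a least one, which depends measurably on the parameter. -/
theorem exists_measurable_isMinOn [MetricSpace Y] [MeasurableSpace Y] [BorelSpace Y] {U : Set Y}
    (hU : IsCompact U) (hne : U.Nonempty) {φ : α → Y → ℝ}
    (hmeas : ∀ y ∈ U, Measurable fun a => φ a y) (hcont : ∀ a, ContinuousOn (φ a) U) :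
    ∃ s : α → Y, Measurable s ∧ ∀ a, s a ∈ U ∧ IsMinOn (φ a) U (s a) := by
  have : Nonempty U := hne.to_subtype
  have : CompactSpace U := isCompact_iff_compactSpace.1 hU
  obtain ⟨q, hq, hq_surj⟩ := exists_nat_bool_continuous_surjective_of_compact U
  set π : cantorSet → U := q ∘ cantorSetHomeomorphNatToBool
  have hπ : Continuous π := hq.comp cantorSetHomeomorphNatToBool.continuous
  have hπ_surj : π.Surjective := hq_surj.comp cantorSetHomeomorphNatToBool.surjective
  obtain ⟨ζ, hζ, hmin⟩ := exists_measurable_isMinOn_of_subset_real isCompact_cantorSet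
    ⟨0, zero_mem_cantorSet⟩ (φ := fun a z => φ a (π z)) (fun z => hmeas _ (π z).2) fun a =>
      (continuousOn_iff_continuous_domRestrict.1 (hcont a)).comp hπ
  refine ⟨fun a => π (ζ a), measurable_subtype_coe.comp (hπ.measurable.comp hζ),
    fun a => ⟨(π (ζ a)).2, fun y hy => ?_⟩⟩
  obtain ⟨z, hz⟩ := hπ_surj ⟨y, hy⟩
  simpa [hz] using hmin a (mem_univ z)

theorem aestronglyMeasurable_comp_of_continuousOn {X E : Type*} [TopologicalSpace X]
    [MeasurableSpace X] [OpensMeasurableSpace X] [TopologicalSpace E]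
    [TopologicalSpace.PseudoMetrizableSpace E] [SecondCountableTopologyEither X E]
    {μ : Measure α} {F : X → E} {s : Set X} (hF : ContinuousOn F s) (hs : MeasurableSet s)
    {w : α → X} (hw : AEMeasurable w μ) (hws : ∀ᵐ a ∂μ, w a ∈ s) :
    AEStronglyMeasurable (fun a => F (w a)) μ := by
  have hmap : (μ.map w).restrict s = μ.map w :=
    Measure.restrict_eq_self_of_ae_mem ((ae_map_iff hw hs).2 hws)
  exact (hmap ▸ hF.aestronglyMeasurable hs).comp_aemeasurable hw

end MeasurableSelection

section VelocitySets

variable {X W E : Type*} [NormedAddCommGroup E] {f : X → W → E}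
  {g : X → W → ℝ} {U : Set W} {A : Set X}

/-- The velocity set at `x` of the control system `x' = f (x, u)` augmented by a cost coordinate,
which may grow at any rate not below the running cost `g (x, u)`. -/
def augmentedVelocitySet (U : Set W) (f : X → W → E) (g : X → W → ℝ) (x : X) : Set (E × ℝ) :=
  {q | ∃ u ∈ U, q.1 = f x u ∧ g x u ≤ q.2}

open scoped Pointwise in
theorem isClosed_augmentedVelocitySet [TopologicalSpace W] (hU : IsCompact U) {x : X}
    (hf : ContinuousOn (f x) U) (hg : ContinuousOn (g x) U) :
    IsClosed (augmentedVelocitySet U f g x) := by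
  have hsum : augmentedVelocitySet U f g x =
      (fun u => (f x u, g x u)) '' U + ({0} ×ˢ Ici 0 : Set (E × ℝ)) := by
    ext ⟨p, c⟩
    simp only [augmentedVelocitySet, mem_ofPred_eq, Set.mem_add, exists_mem_image]
    refine exists_congr fun u => and_congr_right fun _ => ⟨fun h => ?_, ?_⟩
    · exact ⟨(0, c - g x u), ⟨rfl, sub_nonneg.2 h.2⟩, by simp [h.1]⟩
    · rintro ⟨⟨p', d⟩, ⟨rfl : p' = 0, hd : 0 ≤ d⟩, hq⟩
      obtain ⟨rfl, rfl⟩ := Prod.mk_inj.1 hq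
      simpa using hd
  rw [hsum]
  exact (isClosed_singleton.prod isClosed_Ici).add_left_of_isCompact
    (hU.image_of_continuousOn (hf.prodMk hg))

variable [TopologicalSpace X]

theorem eventually_mem_cthickening_augmentedVelocitySet [TopologicalSpace W] (hU : IsCompact U)
    (hf : ContinuousOn f.uncurry (A ×ˢ U)) (hg : ContinuousOn g.uncurry (A ×ˢ U)) {x₀ : X}
    (hx₀ : x₀ ∈ A) {ε : ℝ} (hε : 0 < ε) :
    ∀ᶠ x in 𝓝[A] x₀, ∀ u ∈ U,
      (f x u, g x u) ∈ Metric.cthickening ε (augmentedVelocitySet U f g x₀) := by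
  obtain ⟨v, hv, hclose⟩ := hU.mem_uniformity_of_prod (f := fun x u => (f x u, g x u))
    (hf.prodMk hg) hx₀ (Metric.dist_mem_uniformity hε)
  exact eventually_of_mem hv fun x hx u hu => Metric.mem_cthickening_of_dist_le _
    (f x₀ u, g x₀ u) ε _ ⟨u, hu, rfl, le_rfl⟩ (hclose x hx u hu).le

theorem measurable_apply_of_continuousOn {α Z : Type*} [MeasurableSpace α] [MeasurableSpace X]
    [OpensMeasurableSpace X] [TopologicalSpace W] [TopologicalSpace Z] [MeasurableSpace Z]
    [BorelSpace Z] {F : X → W → Z} (hF : ContinuousOn F.uncurry (A ×ˢ U)) {ξ : α → X}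
    (hξ : Measurable ξ) (hξA : ∀ a, ξ a ∈ A) {u : W} (hu : u ∈ U) :
    Measurable fun a => F (ξ a) u :=
  (continuousOn_iff_continuous_domRestrict.1 (hF.uncurry_right u hu)).measurable.comp
    (hξ.subtype_mk (h := hξA))

/- The control is chosen as a measurable minimizer over `U` of the defect
`‖f (ξ, u) - p.1‖ + (g (ξ, u) - p.2)⁺`. -/
theorem exists_measurable_control_of_mem_augmentedVelocitySet {α : Type*} [MeasurableSpace α]
    {μ : Measure α} [MeasurableSpace X] [OpensMeasurableSpace X] [MetricSpace W]
    [MeasurableSpace W] [BorelSpace W] [MeasurableSpace E] [BorelSpace E]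
    [SecondCountableTopology E] (hU : IsCompact U) (hne : U.Nonempty)
    (hf : ContinuousOn f.uncurry (A ×ˢ U)) (hg : ContinuousOn g.uncurry (A ×ˢ U)) {ξ : α → X}
    (hξ : Measurable ξ) (hξA : ∀ a, ξ a ∈ A) {p : α → E × ℝ} (hp : Measurable p)
    (hmem : ∀ᵐ a ∂μ, p a ∈ augmentedVelocitySet U f g (ξ a)) :
    ∃ u : α → W, Measurable u ∧ (∀ a, u a ∈ U) ∧
      ∀ᵐ a ∂μ, f (ξ a) (u a) = (p a).1 ∧ g (ξ a) (u a) ≤ (p a).2 := by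
  obtain ⟨u, hum, hu⟩ := exists_measurable_isMinOn hU hne
    (φ := fun a w => ‖f (ξ a) w - (p a).1‖ + max (g (ξ a) w - (p a).2) 0)
    (fun w hw => ((measurable_apply_of_continuousOn hf hξ hξA hw).sub hp.fst).norm.add
      (((measurable_apply_of_continuousOn hg hξ hξA hw).sub hp.snd).max measurable_const))
    fun a => ((hf.uncurry_left _ (hξA a)).sub continuousOn_const).norm.add
      (((hg.uncurry_left _ (hξA a)).sub continuousOn_const).sup continuousOn_const)
  refine ⟨u, hum, fun a => (hu a).1, hmem.mono fun a ha => ?_⟩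
  obtain ⟨w, hw, hfw, hgw⟩ := ha
  have hdefect : ‖f (ξ a) (u a) - (p a).1‖ + max (g (ξ a) (u a) - (p a).2) 0 ≤ 0 := by
    simpa [hfw, hgw] using (hu a).2 hw
  have hzero := (add_eq_zero_iff_of_nonneg (norm_nonneg _) (le_max_right _ _)).1
    (hdefect.antisymm (by positivity))
  rwa [norm_eq_zero, sub_eq_zero, max_eq_right_iff, sub_nonpos] at hzero

end VelocitySets

section Trajectories

variable {n m : ℕ} {U : Set (EuclideanSpace ℝ (Fin m))} {G G₁ F : Set (EuclideanSpace ℝ (Fin n))}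
  {f : EuclideanSpace ℝ (Fin n) → EuclideanSpace ℝ (Fin m) → EuclideanSpace ℝ (Fin n)}
  {g : EuclideanSpace ℝ (Fin n) → EuclideanSpace ℝ (Fin m) → ℝ}
  {x₀ : EuclideanSpace ℝ (Fin n)} {u : ℝ → EuclideanSpace ℝ (Fin m)} {I J : Set ℝ}
  {x y : ℝ → EuclideanSpace ℝ (Fin n)} {S T R δ C : ℝ}

theorem IsTrajectory.mono (h : IsTrajectory G₁ f x₀ u I x) (hJ : J ⊆ I) :
    IsTrajectory G₁ f x₀ u J x :=
  ⟨fun t ht => h.mem t (hJ ht), h.continuousOn.mono hJ, fun t ht => h.integrable t (hJ ht),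
    fun t ht => h.eq_integral t (hJ ht)⟩

theorem IsTrajectory.apply_zero (h : IsTrajectory G₁ f x₀ u I x) (h0 : (0 : ℝ) ∈ I) :
    x 0 = x₀ := by
  simpa using h.eq_integral 0 h0

theorem IsTrajectory.sub_eq_integral (h : IsTrajectory G₁ f x₀ u I x) {s t : ℝ} (hs : s ∈ I)
    (ht : t ∈ I) : x t - x s = ∫ τ in s..t, f (x τ) (u τ) := by
  rw [h.eq_integral t ht, h.eq_integral s hs, add_sub_add_left_eq_sub,
    intervalIntegral.integral_interval_sub_left (h.integrable t ht) (h.integrable s hs)]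

theorem IsTrajectory.eqOn_of_norm_sub_le (hx : IsTrajectory G₁ f x₀ u (Icc 0 T) x)
    (hy : IsTrajectory G₁ f x₀ u (Icc 0 T) y)
    (hC : ∀ t ∈ Icc 0 T, ‖f (x t) (u t) - f (y t) (u t)‖ ≤ C * ‖x t - y t‖) :
    EqOn x y (Icc 0 T) := by
  have hcont : ContinuousOn (fun t => ‖x t - y t‖) (Icc 0 T) :=
    (hx.continuousOn.sub hy.continuousOn).norm
  have hzero := eqOn_zero_of_le_mul_integral hcont (fun _ _ => norm_nonneg _) fun t ht => by
    rw [hx.eq_integral t ht, hy.eq_integral t ht, add_sub_add_left_eq_sub,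
      ← intervalIntegral.integral_sub (hx.integrable t ht) (hy.integrable t ht),
      ← intervalIntegral.integral_const_mul]
    exact intervalIntegral.norm_integral_le_of_norm_le ht.1
      (ae_of_all _ fun s hs => hC s ⟨hs.1.le, hs.2.trans ht.2⟩)
      (((hcont.mono (Icc_subset_Icc_right ht.2)).intervalIntegrable_of_Icc ht.1).const_mul C)
  exact fun t ht => sub_eq_zero.1 (norm_eq_zero.1 (hzero ht))

/-- On bounded parts of `F` the right-hand side is Lipschitz in the state, uniformly in the
control. -/
def LipschitzOnBoundedParts (U : Set (EuclideanSpace ℝ (Fin m)))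
    (f : EuclideanSpace ℝ (Fin n) → EuclideanSpace ℝ (Fin m) → EuclideanSpace ℝ (Fin n))
    (F : Set (EuclideanSpace ℝ (Fin n))) : Prop :=
  ∀ R : ℝ, ∃ C : ℝ≥0, ∀ u ∈ U, LipschitzOnWith C (fun x => f x u) (Metric.closedBall 0 R ∩ F)

theorem SystemAssumption.lipschitzOnBoundedParts (h : SystemAssumption U G G₁ f) :
    LipschitzOnBoundedParts U f (closure G) := by
  intro R
  obtain ⟨C, -, hC⟩ := h.lipschitz (max R 1) (by positivity)
  have hsub : Metric.closedBall 0 R ∩ closure G ⊆ Metric.closedBall 0 (max R 1) ∩ closure G :=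
    inter_subset_inter_left _ (Metric.closedBall_subset_closedBall (le_max_left R 1))
  refine ⟨C.toNNReal, fun u hu => LipschitzOnWith.of_dist_le_mul fun x hx y hy => ?_⟩
  rw [dist_eq_norm, dist_eq_norm]
  exact (hC x (hsub hx) y (hsub hy) u hu).trans (by gcongr; exact Real.le_coe_toNNReal C)

theorem LipschitzOnBoundedParts.eqOn (hf : LipschitzOnBoundedParts U f F)
    (hu : ∀ t ∈ Icc 0 T, u t ∈ U) (hx : IsTrajectory G₁ f x₀ u (Icc 0 T) x)
    (hxF : ∀ t ∈ Icc 0 T, x t ∈ F) (hy : IsTrajectory G₁ f x₀ u (Icc 0 T) y)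
    (hyF : ∀ t ∈ Icc 0 T, y t ∈ F) : EqOn x y (Icc 0 T) := by
  obtain ⟨R, hR⟩ := ((isCompact_Icc.image_of_continuousOn hx.continuousOn).union
    (isCompact_Icc.image_of_continuousOn hy.continuousOn)).isBounded.subset_closedBall 0
  obtain ⟨C, hC⟩ := hf R
  refine hx.eqOn_of_norm_sub_le hy (C := C) fun t ht => ?_
  simpa only [dist_eq_norm] using (hC (u t) (hu t ht)).dist_le_mul
    _ ⟨hR (Or.inl (mem_image_of_mem x ht)), hxF t ht⟩
    _ ⟨hR (Or.inr (mem_image_of_mem y ht)), hyF t ht⟩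

/-- Every trajectory that starts at `x₀` stays in `F`. -/
def StronglyInvariantFrom (U : Set (EuclideanSpace ℝ (Fin m)))
    (G₁ : Set (EuclideanSpace ℝ (Fin n)))
    (f : EuclideanSpace ℝ (Fin n) → EuclideanSpace ℝ (Fin m) → EuclideanSpace ℝ (Fin n))
    (F : Set (EuclideanSpace ℝ (Fin n))) (x₀ : EuclideanSpace ℝ (Fin n)) : Prop :=
  ∀ u, IsControl U u → ∀ T x, IsTrajectory G₁ f x₀ u (Icc 0 T) x → ∀ t ∈ Icc 0 T, x t ∈ F

theorem SystemAssumption.stronglyInvariantFrom (h : SystemAssumption U G G₁ f) (hx₀ : x₀ ∈ G) :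
    StronglyInvariantFrom U G₁ f (closure G) x₀ := by
  intro u hu T x hx t ht
  rcases ht.1.eq_or_lt with rfl | ht0
  · exact subset_closure ((hx.apply_zero ht).symm ▸ hx₀)
  have hT : 0 < T := ht0.trans_le ht.2
  have hIco : {t : ℝ | 0 ≤ t ∧ (t : EReal) < (T : EReal)} = Ico 0 T := by
    ext t
    simp
  have hG : MapsTo x (Ico 0 T) G := fun s hs =>
    h.invariant x₀ hx₀ u hu T (by exact_mod_cast hT) x (hIco ▸ hx.mono Ico_subset_Icc_self) s hs.1
      (by exact_mod_cast hs.2)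
  have hclosure : closure (Ico 0 T) = Icc 0 T := closure_Ico hT.ne
  exact hG.closure_of_continuousOn (hclosure ▸ hx.continuousOn) (hclosure ▸ ht)

theorem Reaches.exists_first {T : ℝ≥0} (h : Reaches G₁ f δ x₀ u T x) :
    ∃ τ ≤ T, Reaches G₁ f δ x₀ u τ x ∧ ∀ t ∈ Ico (0 : ℝ) τ, δ < ‖x t‖ := by
  obtain ⟨τ, ⟨hτ, hτδ⟩, hmin⟩ : ∃ τ, IsLeast (Icc (0 : ℝ) T ∩ x ⁻¹' Metric.closedBall 0 δ) τ :=
    (isCompact_Icc.of_isClosed_subset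
      (h.1.continuousOn.preimage_isClosed_of_isClosed isClosed_Icc Metric.isClosed_closedBall)
      inter_subset_left).exists_isLeast ⟨T, ⟨T.2, le_rfl⟩, h.2⟩
  lift τ to ℝ≥0 using hτ.1
  refine ⟨τ, by exact_mod_cast hτ.2, ⟨h.1.mono (Icc_subset_Icc_right hτ.2), hτδ⟩, fun t ht => ?_⟩
  by_contra! hle
  exact ht.2.not_ge (hmin ⟨⟨ht.1, ht.2.le.trans hτ.2⟩, by simpa using hle⟩)

theorem exitTime_eq_of_first (hf : LipschitzOnBoundedParts U f F)
    (hinv : StronglyInvariantFrom U G₁ f F x₀) (hu : IsControl U u) {τ : ℝ≥0}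
    (hτ : Reaches G₁ f δ x₀ u τ x) (hout : ∀ t ∈ Ico (0 : ℝ) τ, δ < ‖x t‖) :
    exitTime G₁ f δ x₀ u = τ := by
  refine le_antisymm (sInf_le ⟨τ, x, hτ, rfl⟩) (le_sInf ?_)
  rintro _ ⟨τ', y, hy, rfl⟩
  by_contra! hlt
  have hlt : τ' < τ := by exact_mod_cast hlt
  have hx : IsTrajectory G₁ f x₀ u (Icc 0 (τ' : ℝ)) x :=
    hτ.1.mono (Icc_subset_Icc_right (by exact_mod_cast hlt.le))
  have heq : x τ' = y τ' := hf.eqOn (fun t ht => hu.mem t ht.1) hx (hinv u hu _ x hx) hy.1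
    (hinv u hu _ y hy.1) ⟨τ'.2, le_rfl⟩
  exact (hout τ' ⟨τ'.2, by exact_mod_cast hlt⟩).not_ge (by simpa [heq] using hy.2)

theorem runningCost_congr (h : EqOn x y (Icc 0 T)) :
    runningCost g x u T = runningCost g y u T :=
  setLIntegral_congr_fun measurableSet_Icc fun t ht => by simp only [h ht]

theorem runningCost_mono (h : S ≤ T) : runningCost g x u S ≤ runningCost g x u T :=
  lintegral_mono_set (Icc_subset_Icc_right h)

theorem runningCost_lt_top (hU : IsCompact U) (hg : ContinuousOn g.uncurry (F ×ˢ U))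
    (hu : ∀ t ∈ Icc 0 T, u t ∈ U) (hx : ContinuousOn x (Icc 0 T)) (hxF : MapsTo x (Icc 0 T) F) :
    runningCost g x u T < ∞ := by
  obtain ⟨B, hB⟩ := (((isCompact_Icc.image_of_continuousOn hx).prod hU).image_of_continuousOn
    (hg.mono (prod_mono hxF.image_subset le_rfl))).isBounded.exists_norm_le
  calc runningCost g x u T ≤ ∫⁻ _ in Icc 0 T, ENNReal.ofReal B :=
        setLIntegral_mono' measurableSet_Icc fun t ht => ENNReal.ofReal_le_ofReal
          ((le_abs_self _).trans (hB _ ⟨(x t, u t), ⟨⟨t, ht, rfl⟩, hu t ht⟩, rfl⟩))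
    _ < ∞ := by simp [ENNReal.mul_lt_top]

theorem ofReal_mul_le_runningCost (hT : 0 ≤ T) (hC : ∀ t ∈ Ico 0 T, C ≤ g (x t) (u t)) :
    ENNReal.ofReal (C * T) ≤ runningCost g x u T := by
  calc ENNReal.ofReal (C * T) = ∫⁻ _ in Ico 0 T, ENNReal.ofReal C := by
        simp [ENNReal.ofReal_mul' hT]
    _ ≤ ∫⁻ t in Ico 0 T, ENNReal.ofReal (g (x t) (u t)) :=
        setLIntegral_mono' measurableSet_Ico fun t ht => ENNReal.ofReal_le_ofReal (hC t ht)
    _ ≤ _ := lintegral_mono_set Ico_subset_Icc_self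

theorem IsTrajectory.ofReal_mul_dist_le_runningCost (hx : IsTrajectory G₁ f x₀ u (Icc 0 T) x)
    (hC : 0 ≤ C) {s t : ℝ} (hs : s ∈ Icc 0 T) (ht : t ∈ Icc 0 T) (hst : s ≤ t)
    (hg : ∀ τ ∈ Ioc s t, C * ‖f (x τ) (u τ)‖ ≤ g (x τ) (u τ)) :
    ENNReal.ofReal (C * dist (x t) (x s)) ≤ runningCost g x u T := by
  rw [dist_eq_norm, ENNReal.ofReal_mul hC, ofReal_norm, hx.sub_eq_integral hs ht,
    intervalIntegral.integral_of_le hst]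
  calc ENNReal.ofReal C * ‖∫ τ in Ioc s t, f (x τ) (u τ)‖ₑ
      ≤ ENNReal.ofReal C * ∫⁻ τ in Ioc s t, ‖f (x τ) (u τ)‖ₑ := by
        gcongr
        exact enorm_integral_le_lintegral_enorm _
    _ = ∫⁻ τ in Ioc s t, ENNReal.ofReal (C * ‖f (x τ) (u τ)‖) := by
        simp only [ENNReal.ofReal_mul hC, ofReal_norm]
        exact (lintegral_const_mul' _ _ ENNReal.ofReal_ne_top).symm
    _ ≤ ∫⁻ τ in Ioc s t, ENNReal.ofReal (g (x τ) (u τ)) :=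
        setLIntegral_mono' measurableSet_Ioc fun τ hτ => ENNReal.ofReal_le_ofReal (hg τ hτ)
    _ ≤ runningCost g x u T :=
        lintegral_mono_set fun τ hτ => ⟨hs.1.trans hτ.1.le, hτ.2.trans ht.2⟩

/- Only the arc after the last visit to the ball of radius `R` counts. -/
theorem IsTrajectory.ofReal_mul_norm_sub_le_runningCost
    (hx : IsTrajectory G₁ f x₀ u (Icc 0 T) x) (hC : 0 ≤ C) (hR : ‖x₀‖ ≤ R)
    (hg : ∀ t ∈ Icc 0 T, R ≤ ‖x t‖ → C * ‖f (x t) (u t)‖ ≤ g (x t) (u t)) {t : ℝ}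
    (ht : t ∈ Icc 0 T) : ENNReal.ofReal (C * (‖x t‖ - R)) ≤ runningCost g x u T := by
  obtain ⟨s, ⟨hs, hsR⟩, hlast⟩ :
      ∃ s, IsGreatest (Icc (0 : ℝ) t ∩ x ⁻¹' Metric.closedBall 0 R) s :=
    (isCompact_Icc.of_isClosed_subset
      ((hx.continuousOn.mono (Icc_subset_Icc_right ht.2)).preimage_isClosed_of_isClosed
        isClosed_Icc Metric.isClosed_closedBall) inter_subset_left).exists_isGreatest
      ⟨0, ⟨le_rfl, ht.1⟩, by simpa [hx.apply_zero ⟨le_rfl, ht.1.trans ht.2⟩] using hR⟩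
  have hout : ∀ τ ∈ Ioc s t, R ≤ ‖x τ‖ := fun τ hτ => by
    by_contra! hlt
    exact hτ.1.not_ge (hlast ⟨⟨hs.1.trans hτ.1.le, hτ.2⟩, by simpa using hlt.le⟩)
  have hdist : ‖x t‖ - R ≤ dist (x t) (x s) := by
    have hxs : ‖x s‖ ≤ R := by simpa using hsR
    rw [dist_eq_norm]
    linarith [norm_sub_norm_le (x t) (x s)]
  refine (ENNReal.ofReal_le_ofReal (by gcongr)).trans
    (hx.ofReal_mul_dist_le_runningCost hC ⟨hs.1, hs.2.trans ht.2⟩ ht hs.2 fun τ hτ => ?_)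
  exact hg τ ⟨hs.1.trans hτ.1.le, hτ.2.trans ht.2⟩ (hout τ hτ)

end Trajectories

section Filippov

variable {n m : ℕ} {U : Set (EuclideanSpace ℝ (Fin m))} {G₁ A : Set (EuclideanSpace ℝ (Fin n))}
  {f : EuclideanSpace ℝ (Fin n) → EuclideanSpace ℝ (Fin m) → EuclideanSpace ℝ (Fin n)}
  {g : EuclideanSpace ℝ (Fin n) → EuclideanSpace ℝ (Fin m) → ℝ}
  {x₀ : EuclideanSpace ℝ (Fin n)} {u : ℝ → EuclideanSpace ℝ (Fin m)}
  {x : ℝ → EuclideanSpace ℝ (Fin n)} {K : ℝ≥0} {T : ℝ}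

theorem isTrajectory_of_ae_deriv_eq (hx : LipschitzWith K x) (hxG : MapsTo x (Icc 0 T) G₁)
    (hder : ∀ᵐ t ∂volume.restrict (Icc 0 T), deriv x t = f (x t) (u t)) :
    IsTrajectory G₁ f (x 0) u (Icc 0 T) x := by
  have heq : ∀ t ∈ Icc 0 T, deriv x =ᵐ[volume.restrict (uIoc 0 t)] fun s => f (x s) (u s) :=
    fun t ht => ae_restrict_of_ae_restrict_of_subset
      (uIoc_of_le ht.1 ▸ Ioc_subset_Icc_self.trans (Icc_subset_Icc_right ht.2)) hder
  refine ⟨hxG, hx.continuous.continuousOn, fun t ht =>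
    (intervalIntegrable_deriv_of_lipschitzWith hx 0 t).congr_ae (heq t ht), fun t ht => ?_⟩
  rw [← intervalIntegral.integral_congr_ae_restrict (heq t ht),
    integral_deriv_of_lipschitzWith hx, add_sub_cancel]

theorem runningCost_le_of_ae_le_deriv {c : ℝ → ℝ} (hc : LipschitzWith K c) (hT : 0 ≤ T)
    (hg : ∀ᵐ t ∂volume.restrict (Icc 0 T), 0 ≤ g (x t) (u t) ∧ g (x t) (u t) ≤ deriv c t) :
    runningCost g x u T ≤ ENNReal.ofReal (c T - c 0) := by
  have hint : IntegrableOn (deriv c) (Icc 0 T) := by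
    rw [integrableOn_Icc_iff_integrableOn_Ioc, ← intervalIntegrable_iff_integrableOn_Ioc_of_le hT]
    exact intervalIntegrable_deriv_of_lipschitzWith hc 0 T
  calc runningCost g x u T ≤ ∫⁻ t in Icc 0 T, ENNReal.ofReal (deriv c t) :=
        lintegral_mono_ae (hg.mono fun t ht => ENNReal.ofReal_le_ofReal ht.2)
    _ = ENNReal.ofReal (∫ t in Icc 0 T, deriv c t) :=
        (ofReal_integral_eq_lintegral_ofReal hint (hg.mono fun t ht => ht.1.trans ht.2)).symm
    _ = ENNReal.ofReal (c T - c 0) := by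
        rw [integral_Icc_eq_integral_Ioc, ← intervalIntegral.integral_of_le hT,
          integral_deriv_of_lipschitzWith hc]

theorem exists_isControl_of_ae_mem_augmentedVelocitySet (hU : IsCompact U) (hne : U.Nonempty)
    (hf : ContinuousOn f.uncurry (A ×ˢ U)) (hg : ContinuousOn g.uncurry (A ×ˢ U))
    (hT : 0 ≤ T) (hx : ContinuousOn x (Icc 0 T)) (hxA : MapsTo x (Icc 0 T) A)
    {p : ℝ → EuclideanSpace ℝ (Fin n) × ℝ} (hp : Measurable p)
    (hmem : ∀ᵐ t ∂volume.restrict (Icc 0 T), p t ∈ augmentedVelocitySet U f g (x t)) :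
    ∃ u, IsControl U u ∧ ∀ᵐ t ∂volume.restrict (Icc 0 T),
      f (x t) (u t) = (p t).1 ∧ g (x t) (u t) ≤ (p t).2 := by
  set ξ : ℝ → EuclideanSpace ℝ (Fin n) := fun t => x (projIcc 0 T hT t) with hξ
  have hξx : ∀ᵐ t ∂volume.restrict (Icc 0 T), ξ t = x t :=
    (ae_restrict_iff' measurableSet_Icc).2 (ae_of_all _ fun t ht => by
      simp only [hξ, projIcc_of_mem hT ht])
  have hξm : Measurable ξ := Continuous.measurable
    (hx.comp_continuous (by fun_prop) fun t => (projIcc 0 T hT t).2)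
  obtain ⟨u, hum, huU, hu⟩ := exists_measurable_control_of_mem_augmentedVelocitySet hU hne hf hg
    hξm (fun t => hxA (projIcc 0 T hT t).2) hp
    (by filter_upwards [hmem, hξx] with t ht heq using heq ▸ ht)
  obtain ⟨M, hM⟩ := hU.isBounded.exists_norm_le
  refine ⟨u, ⟨fun t _ => huU t, fun S => memLp_top_of_bound hum.aestronglyMeasurable M
    (ae_of_all _ fun t => hM _ (huU t))⟩, ?_⟩
  filter_upwards [hu, hξx] with t ht heq using heq ▸ ht

theorem exists_isTrajectory_of_deriv_mem_augmentedVelocitySet (hU : IsCompact U)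
    (hne : U.Nonempty) (hAG : A ⊆ G₁) (hf : ContinuousOn f.uncurry (A ×ˢ U))
    (hg : ContinuousOn g.uncurry (A ×ˢ U)) (hg0 : ∀ x ∈ A, ∀ u ∈ U, 0 ≤ g x u)
    {X : ℝ → EuclideanSpace ℝ (Fin n) × ℝ} (hX : LipschitzWith K X) (hX0 : X 0 = (x₀, 0))
    (hT : 0 ≤ T) (hXA : ∀ t ∈ Icc 0 T, (X t).1 ∈ A)
    (hder : ∀ᵐ t ∂volume.restrict (Icc 0 T),
      deriv X t ∈ augmentedVelocitySet U f g (X t).1) :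
    ∃ u, IsControl U u ∧ IsTrajectory G₁ f x₀ u (Icc 0 T) (fun t => (X t).1) ∧
      runningCost g (fun t => (X t).1) u T ≤ ENNReal.ofReal (X T).2 := by
  have hX₁ : LipschitzWith K fun t => (X t).1 := one_mul K ▸ LipschitzWith.prod_fst.comp hX
  have hX₂ : LipschitzWith K fun t => (X t).2 := one_mul K ▸ LipschitzWith.prod_snd.comp hX
  have hdiff : ∀ᵐ t ∂volume.restrict (Icc 0 T), DifferentiableAt ℝ X t :=
    ae_restrict_of_ae hX.ae_differentiableAt_real
  obtain ⟨u, hu, hfg⟩ := exists_isControl_of_ae_mem_augmentedVelocitySet hU hne hf hg hT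
    hX₁.continuous.continuousOn hXA (measurable_deriv X) hder
  have htraj : IsTrajectory G₁ f (X 0).1 u (Icc 0 T) fun t => (X t).1 := by
    refine isTrajectory_of_ae_deriv_eq hX₁ (fun t ht => hAG (hXA t ht)) ?_
    filter_upwards [hdiff, hfg] with t htX ht
    rw [ht.1]
    exact htX.hasFDerivAt.fst.hasDerivAt.deriv
  have hcost : runningCost g (fun t => (X t).1) u T ≤ ENNReal.ofReal ((X T).2 - (X 0).2) := by
    refine runningCost_le_of_ae_le_deriv hX₂ hT ?_
    filter_upwards [hdiff, hfg, ae_restrict_mem measurableSet_Icc] with t htX ht htT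
    refine ⟨hg0 _ (hXA t htT) _ (hu.mem t htT.1), ht.2.trans_eq ?_⟩
    exact htX.hasFDerivAt.snd.hasDerivAt.deriv.symm
  rw [hX0] at htraj hcost
  exact ⟨u, hu, htraj, by simpa using hcost⟩

end Filippov

section Closure

variable {n m : ℕ} {U : Set (EuclideanSpace ℝ (Fin m))} {G₁ A : Set (EuclideanSpace ℝ (Fin n))}
  {f : EuclideanSpace ℝ (Fin n) → EuclideanSpace ℝ (Fin m) → EuclideanSpace ℝ (Fin n)}
  {g : EuclideanSpace ℝ (Fin n) → EuclideanSpace ℝ (Fin m) → ℝ}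
  {x₀ : EuclideanSpace ℝ (Fin n)}

section

variable {x : ℝ → EuclideanSpace ℝ (Fin n)} {u : ℝ → EuclideanSpace ℝ (Fin m)} {T t : ℝ}

/-- The velocity of the state and of the accumulated cost along the curve `x` with control `u`,
switched off outside `(0, T]`; it is defined at all times so that curves with different terminal
times can be compared. -/
noncomputable def stoppedVelocity
    (f : EuclideanSpace ℝ (Fin n) → EuclideanSpace ℝ (Fin m) → EuclideanSpace ℝ (Fin n))
    (g : EuclideanSpace ℝ (Fin n) → EuclideanSpace ℝ (Fin m) → ℝ)
    (x : ℝ → EuclideanSpace ℝ (Fin n)) (u : ℝ → EuclideanSpace ℝ (Fin m)) (T : ℝ) :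
    ℝ → EuclideanSpace ℝ (Fin n) × ℝ :=
  (Ioc 0 T).indicator fun s => (f (x s) (u s), g (x s) (u s))

/-- The state together with the accumulated cost, started at `(x₀, 0)` and frozen from time `T`
on. -/
noncomputable def augmentedTrajectory
    (f : EuclideanSpace ℝ (Fin n) → EuclideanSpace ℝ (Fin m) → EuclideanSpace ℝ (Fin n))
    (g : EuclideanSpace ℝ (Fin n) → EuclideanSpace ℝ (Fin m) → ℝ) (x₀ : EuclideanSpace ℝ (Fin n))
    (x : ℝ → EuclideanSpace ℝ (Fin n)) (u : ℝ → EuclideanSpace ℝ (Fin m)) (T t : ℝ) :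
    EuclideanSpace ℝ (Fin n) × ℝ :=
  (x₀, 0) + ∫ s in (0 : ℝ)..t, stoppedVelocity f g x u T s

theorem stoppedVelocity_apply (ht : t ∈ Ioc 0 T) :
    stoppedVelocity f g x u T t = (f (x t) (u t), g (x t) (u t)) :=
  indicator_of_mem ht _

theorem augmentedTrajectory_zero : augmentedTrajectory f g x₀ x u T 0 = (x₀, 0) := by
  simp [augmentedTrajectory]

theorem norm_stoppedVelocity_le {B : ℝ≥0}
    (hB : ∀ t ∈ Ioc 0 T, ‖(f (x t) (u t), g (x t) (u t))‖ ≤ B) (t : ℝ) :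
    ‖stoppedVelocity f g x u T t‖ ≤ B := by
  by_cases ht : t ∈ Ioc 0 T
  · exact stoppedVelocity_apply (f := f) ht ▸ hB t ht
  · simp [stoppedVelocity, indicator_of_notMem ht]

theorem intervalIntegrable_stoppedVelocity (hU : IsCompact U) (hA : IsCompact A)
    (hf : ContinuousOn f.uncurry (A ×ˢ U)) (hg : ContinuousOn g.uncurry (A ×ˢ U))
    (hu : IsControl U u) (hx : ContinuousOn x (Icc 0 T)) (hxA : MapsTo x (Icc 0 T) A) (a b : ℝ) :
    IntervalIntegrable (stoppedVelocity f g x u T) volume a b := by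
  refine Integrable.intervalIntegrable ((integrable_indicator_iff measurableSet_Ioc).2 ?_)
  obtain ⟨B, hB⟩ := ((hA.prod hU).image_of_continuousOn (hf.prodMk hg)).isBounded.exists_norm_le
  have hmem : ∀ t ∈ Ioc 0 T, (x t, u t) ∈ A ×ˢ U := fun t ht =>
    ⟨hxA (Ioc_subset_Icc_self ht), hu.mem t ht.1.le⟩
  have hxm : AEMeasurable x (volume.restrict (Ioc 0 T)) :=
    (hx.mono Ioc_subset_Icc_self).aemeasurable measurableSet_Ioc
  have hum : AEMeasurable u (volume.restrict (Ioc 0 T)) :=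
    ((hu.locallyBounded T).1.mono_measure
      (Measure.restrict_mono Ioc_subset_Icc_self le_rfl)).aemeasurable
  refine Integrable.of_bound (C := B) ?_
    ((ae_restrict_iff' measurableSet_Ioc).2 (ae_of_all _ fun t ht => hB _ ⟨_, hmem t ht, rfl⟩))
  exact aestronglyMeasurable_comp_of_continuousOn (hf.prodMk hg)
    (hA.measurableSet.prod hU.measurableSet) (hxm.prodMk hum)
    ((ae_restrict_iff' measurableSet_Ioc).2 (ae_of_all _ hmem))

theorem exists_lipschitzWith_augmentedTrajectory (hU : IsCompact U) (hA : IsCompact A)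
    (hf : ContinuousOn f.uncurry (A ×ˢ U)) (hg : ContinuousOn g.uncurry (A ×ˢ U))
    (x₀ : EuclideanSpace ℝ (Fin n)) :
    ∃ K : ℝ≥0, ∀ u, IsControl U u → ∀ T x, ContinuousOn x (Icc 0 T) → MapsTo x (Icc 0 T) A →
      LipschitzWith K (augmentedTrajectory f g x₀ x u T) := by
  obtain ⟨B, hB⟩ := ((hA.prod hU).image_of_continuousOn (hf.prodMk hg)).isBounded.exists_norm_le
  refine ⟨B.toNNReal, fun u hu T x hx hxA => lipschitzWith_add_integral
    (intervalIntegrable_stoppedVelocity hU hA hf hg hu hx hxA)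
    (norm_stoppedVelocity_le fun t ht => ?_) _ _⟩
  exact (hB _ ⟨(x t, u t), ⟨hxA (Ioc_subset_Icc_self ht), hu.mem t ht.1.le⟩, rfl⟩).trans
    (Real.le_coe_toNNReal B)

theorem fst_augmentedTrajectory (hx : IsTrajectory G₁ f x₀ u (Icc 0 T) x)
    (hint : ∀ a b, IntervalIntegrable (stoppedVelocity f g x u T) volume a b)
    (ht : t ∈ Icc 0 T) : (augmentedTrajectory f g x₀ x u T t).1 = x t := by
  rw [hx.eq_integral t ht, augmentedTrajectory, Prod.fst_add,
    intervalIntegral.integral_of_le ht.1, intervalIntegral.integral_of_le ht.1,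
    fst_integral (hint 0 t).1]
  refine congr_arg _ (setIntegral_congr_fun measurableSet_Ioc fun s hs => ?_)
  simp only [stoppedVelocity_apply ⟨hs.1, hs.2.trans ht.2⟩]

theorem ofReal_snd_augmentedTrajectory (hT : 0 ≤ T)
    (hint : ∀ a b, IntervalIntegrable (stoppedVelocity f g x u T) volume a b)
    (hg0 : ∀ t ∈ Icc 0 T, 0 ≤ g (x t) (u t)) :
    ENNReal.ofReal (augmentedTrajectory f g x₀ x u T T).2 = runningCost g x u T := by
  have heq : EqOn (fun s => (stoppedVelocity f g x u T s).2) (fun s => g (x s) (u s))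
      (Ioc 0 T) := fun s hs => by simp only [stoppedVelocity_apply hs]
  have hg : IntegrableOn (fun s => g (x s) (u s)) (Ioc 0 T) :=
    IntegrableOn.congr_fun (hint 0 T).1.snd heq measurableSet_Ioc
  rw [augmentedTrajectory, Prod.snd_add, zero_add, intervalIntegral.integral_of_le hT,
    snd_integral (hint 0 T).1, setIntegral_congr_fun measurableSet_Ioc heq,
    ofReal_integral_eq_lintegral_ofReal hg ((ae_restrict_iff' measurableSet_Ioc).2
      (ae_of_all _ fun s hs => hg0 s (Ioc_subset_Icc_self hs))),
    runningCost, setLIntegral_congr Ioc_ae_eq_Icc]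

end

section

variable {ι : Type*} {l : Filter ι} {T : ι → ℝ} {τ : ℝ}

theorem tendsto_apply_of_lipschitzWith {E : Type*} [PseudoMetricSpace E] {F : ι → ℝ → E}
    {φ : ℝ → E} {K : ℝ≥0} (hF : ∀ k, LipschitzWith K (F k))
    (hlim : ∀ t, Tendsto (fun k => F k t) l (𝓝 (φ t))) (hT : Tendsto T l (𝓝 τ)) :
    Tendsto (fun k => F k (T k)) l (𝓝 (φ τ)) :=
  (tendsto_uncurry_of_lipschitzWith hF (hlim τ)).comp (tendsto_id.prodMk hT)

theorem mem_of_tendsto_of_lipschitzWith [l.NeBot] {E : Type*} [PseudoMetricSpace E]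
    {F : ι → ℝ → E} {φ : ℝ → E} {K : ℝ≥0} (hF : ∀ k, LipschitzWith K (F k))
    (hlim : ∀ t, Tendsto (fun k => F k t) l (𝓝 (φ t))) (hT : Tendsto T l (𝓝 τ))
    (hT0 : ∀ k, 0 ≤ T k) {A : Set E} (hA : IsClosed A) (hFA : ∀ k, MapsTo (F k) (Icc 0 (T k)) A) :
    MapsTo φ (Icc 0 τ) A := fun t ht => by
  have hmin : Tendsto (fun k => min t (T k)) l (𝓝 t) := by
    simpa [ht.2] using (tendsto_const_nhds (x := t)).min hT
  exact hA.mem_of_tendsto (tendsto_apply_of_lipschitzWith hF hlim hmin)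
    (Eventually.of_forall fun k => hFA k ⟨le_min ht.1 (hT0 k), min_le_right _ _⟩)

variable {u : ι → ℝ → EuclideanSpace ℝ (Fin m)} {x : ι → ℝ → EuclideanSpace ℝ (Fin n)}

theorem eventually_stoppedVelocity_mem_cthickening (hU : IsCompact U)
    (hf : ContinuousOn f.uncurry (A ×ˢ U)) (hg : ContinuousOn g.uncurry (A ×ˢ U))
    (hu : ∀ k, IsControl U (u k)) (hxA : ∀ k, MapsTo (x k) (Icc 0 (T k)) A)
    (hT : Tendsto T l (𝓝 τ)) {t : ℝ} (ht : t ∈ Ioo 0 τ) {y : EuclideanSpace ℝ (Fin n)}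
    (hy : y ∈ A) {X : ι → ℝ → EuclideanSpace ℝ (Fin n)}
    (hX : Tendsto (fun q : ι × ℝ => X q.1 q.2) (l ×ˢ 𝓝 t) (𝓝 y))
    (hXx : ∀ k, EqOn (X k) (x k) (Icc 0 (T k))) {ε : ℝ} (hε : 0 < ε) :
    ∀ᶠ q : ι × ℝ in l ×ˢ 𝓝 t, stoppedVelocity f g (x q.1) (u q.1) (T q.1) q.2 ∈
      Metric.cthickening ε (augmentedVelocitySet U f g y) := by
  have htime : ∀ᶠ q : ι × ℝ in l ×ˢ 𝓝 t, q.2 ∈ Ioc 0 (T q.1) :=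
    (tendsto_snd.eventually_const_lt ht.1).and
      ((tendsto_snd.eventually_lt (hT.comp tendsto_fst) ht.2).mono fun _ => le_of_lt)
  have hstate : Tendsto (fun q : ι × ℝ => x q.1 q.2) (l ×ˢ 𝓝 t) (𝓝[A] y) :=
    tendsto_nhdsWithin_iff.2 ⟨hX.congr' (htime.mono fun q hq => hXx q.1 (Ioc_subset_Icc_self hq)),
      htime.mono fun q hq => hxA q.1 (Ioc_subset_Icc_self hq)⟩
  filter_upwards [htime, hstate.eventually
    (eventually_mem_cthickening_augmentedVelocitySet hU hf hg hy hε)] with q hq hnear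
  rw [stoppedVelocity_apply hq]
  exact hnear _ ((hu q.1).mem _ hq.1.le)

theorem deriv_mem_augmentedVelocitySet_of_tendsto [l.NeBot] (hU : IsCompact U) (hA : IsCompact A)
    (hf : ContinuousOn f.uncurry (A ×ˢ U)) (hg : ContinuousOn g.uncurry (A ×ˢ U))
    (hu : ∀ k, IsControl U (u k)) (hx : ∀ k, IsTrajectory G₁ f x₀ (u k) (Icc 0 (T k)) (x k))
    (hxA : ∀ k, MapsTo (x k) (Icc 0 (T k)) A) (hT : Tendsto T l (𝓝 τ)) {K : ℝ≥0}
    (hlip : ∀ k, LipschitzWith K (augmentedTrajectory f g x₀ (x k) (u k) (T k)))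
    {X : ℝ → EuclideanSpace ℝ (Fin n) × ℝ}
    (hlim : ∀ t, Tendsto (fun k => augmentedTrajectory f g x₀ (x k) (u k) (T k) t) l (𝓝 (X t)))
    {t : ℝ} (ht : t ∈ Ioo 0 τ) (hXt : (X t).1 ∈ A) (hdiff : DifferentiableAt ℝ X t)
    (hconv : Convex ℝ (augmentedVelocitySet U f g (X t).1)) :
    deriv X t ∈ augmentedVelocitySet U f g (X t).1 := by
  have hint : ∀ k a b, IntervalIntegrable (stoppedVelocity f g (x k) (u k) (T k)) volume a b :=
    fun k => intervalIntegrable_stoppedVelocity hU hA hf hg (hu k) (hx k).continuousOn (hxA k)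
  have hjoint := ((continuous_fst.tendsto _).comp
    (tendsto_uncurry_of_lipschitzWith hlip (hlim t)))
  have hnear : ∀ ε > 0, ∀ᶠ q : ι × ℝ in l ×ˢ 𝓝 t,
      stoppedVelocity f g (x q.1) (u q.1) (T q.1) q.2 ∈
        Metric.cthickening ε (augmentedVelocitySet U f g (X t).1) := fun ε hε =>
    eventually_stoppedVelocity_mem_cthickening hU hf hg hu hxA hT ht hXt hjoint
      (fun k s hs => fst_augmentedTrajectory (hx k) (hint k) hs) hε
  refine hasDerivAt_mem_of_tendsto_integral hconv
    (isClosed_augmentedVelocitySet hU (hf.uncurry_left _ hXt) (hg.uncurry_left _ hXt)) hint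
    (fun k a b => ?_) hlim hdiff.hasDerivAt
    fun ε hε => (hnear ε hε).filter_mono (prod_mono_right l nhdsWithin_le_nhds)
  rw [augmentedTrajectory, augmentedTrajectory, add_sub_add_left_eq_sub,
    intervalIntegral.integral_interval_sub_left (hint k _ _) (hint k _ _)]

theorem exists_isTrajectory_of_tendsto_runningCost (l : Ultrafilter ι) (hU : IsCompact U)
    (hA : IsCompact A) (hAG : A ⊆ G₁) (hf : ContinuousOn f.uncurry (A ×ˢ U))
    (hg : ContinuousOn g.uncurry (A ×ˢ U)) (hg0 : ∀ x ∈ A, ∀ u ∈ U, 0 ≤ g x u)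
    (hconv : ∀ x ∈ A, Convex ℝ (augmentedVelocitySet U f g x)) {S : ℝ} {V : ℝ≥0∞}
    (hu : ∀ k, IsControl U (u k)) (hT : ∀ k, T k ∈ Icc 0 S)
    (hx : ∀ k, IsTrajectory G₁ f x₀ (u k) (Icc 0 (T k)) (x k))
    (hxA : ∀ k, MapsTo (x k) (Icc 0 (T k)) A)
    (hV : Tendsto (fun k => runningCost g (x k) (u k) (T k)) l (𝓝 V)) :
    ∃ w, IsControl U w ∧ ∃ τ, 0 ≤ τ ∧ ∃ y, IsTrajectory G₁ f x₀ w (Icc 0 τ) y ∧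
      Tendsto (fun k => x k (T k)) l (𝓝 (y τ)) ∧ runningCost g y w τ ≤ V := by
  obtain ⟨k₀⟩ := (l : Filter ι).nonempty_of_neBot
  obtain ⟨K, hK⟩ := exists_lipschitzWith_augmentedTrajectory hU hA hf hg x₀
  have hint : ∀ k a b, IntervalIntegrable (stoppedVelocity f g (x k) (u k) (T k)) volume a b :=
    fun k => intervalIntegrable_stoppedVelocity hU hA hf hg (hu k) (hx k).continuousOn (hxA k)
  have hlip : ∀ k, LipschitzWith K (augmentedTrajectory f g x₀ (x k) (u k) (T k)) := fun k =>
    hK _ (hu k) _ _ (hx k).continuousOn (hxA k)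
  obtain ⟨X, hXlip, hX⟩ := exists_lipschitzWith_tendsto_ultrafilter l hlip (a := 0)
    fun k => augmentedTrajectory_zero
  have hX0 : X 0 = (x₀, 0) := tendsto_nhds_unique (hX 0)
    (tendsto_const_nhds.congr fun k => augmentedTrajectory_zero.symm)
  obtain ⟨τ, hτ⟩ := exists_tendsto_ultrafilter_of_mem_compact l isCompact_Icc hT
  have hτ0 : 0 ≤ τ := ge_of_tendsto' hτ fun k => (hT k).1
  have hend := tendsto_apply_of_lipschitzWith hlip hX hτ
  have hXA : ∀ t ∈ Icc 0 τ, (X t).1 ∈ A :=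
    mem_of_tendsto_of_lipschitzWith hlip hX hτ (fun k => (hT k).1)
      (hA.isClosed.preimage continuous_fst) fun k t ht => by
        rw [mem_preimage, fst_augmentedTrajectory (hx k) (hint k) ht]
        exact hxA k ht
  obtain ⟨w, hw, hy, hcost⟩ := exists_isTrajectory_of_deriv_mem_augmentedVelocitySet hU
    ⟨u k₀ 0, (hu k₀).mem 0 le_rfl⟩ hAG hf hg hg0 hXlip hX0 hτ0 hXA (by
      rw [← restrict_Ioo_eq_restrict_Icc, ae_restrict_iff' measurableSet_Ioo]
      filter_upwards [hXlip.ae_differentiableAt_real] with t hdiff ht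
      have hXt := hXA t (Ioo_subset_Icc_self ht)
      exact deriv_mem_augmentedVelocitySet_of_tendsto hU hA hf hg hu hx hxA hτ hlip hX ht hXt
        hdiff (hconv _ hXt))
  refine ⟨w, hw, τ, hτ0, _, hy, ?_, hcost.trans_eq ?_⟩
  · exact ((continuous_fst.tendsto _).comp hend).congr fun k =>
      fst_augmentedTrajectory (hx k) (hint k) ⟨(hT k).1, le_rfl⟩
  · refine tendsto_nhds_unique (((ENNReal.continuous_ofReal.comp continuous_snd).tendsto _).comp
      hend) (hV.congr fun k => ?_)
    exact (ofReal_snd_augmentedTrajectory (hT k).1 (hint k) fun t ht =>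
      hg0 _ (hxA k ht) _ ((hu k).mem t ht.1)).symm

end

end Closure

section Optimality

variable {n m : ℕ} {U : Set (EuclideanSpace ℝ (Fin m))} {G G₁ F : Set (EuclideanSpace ℝ (Fin n))}
  {f : EuclideanSpace ℝ (Fin n) → EuclideanSpace ℝ (Fin m) → EuclideanSpace ℝ (Fin n)}
  {g : EuclideanSpace ℝ (Fin n) → EuclideanSpace ℝ (Fin m) → ℝ}
  {x₀ : EuclideanSpace ℝ (Fin n)} {u : ℝ → EuclideanSpace ℝ (Fin m)}
  {x : ℝ → EuclideanSpace ℝ (Fin n)} {δ : ℝ}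

theorem freeTimeValue_le {T : ℝ≥0} (hu : IsControl U u) (h : Reaches G₁ f δ x₀ u T x) :
    freeTimeValue U G₁ f g δ x₀ ≤ runningCost g x u T :=
  sInf_le ⟨u, hu, T, x, h, rfl⟩

theorem freeTimeValue_lt_top (hU : IsCompact U) (hg : ContinuousOn g.uncurry (F ×ˢ U))
    (hinv : StronglyInvariantFrom U G₁ f F x₀)
    (hreach : ∃ u, IsControl U u ∧ ∃ T x, Reaches G₁ f δ x₀ u T x) :
    freeTimeValue U G₁ f g δ x₀ < ∞ := by
  obtain ⟨u, hu, T, x, hx⟩ := hreach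
  exact (freeTimeValue_le hu hx).trans_lt (runningCost_lt_top hU hg (fun t ht => hu.mem t ht.1)
    hx.1.continuousOn (hinv u hu T x hx.1))

theorem Reaches.exists_exitTime_eq {T : ℝ≥0} (hx : Reaches G₁ f δ x₀ u T x)
    (hf : LipschitzOnBoundedParts U f F) (hinv : StronglyInvariantFrom U G₁ f F x₀)
    (hu : IsControl U u) :
    ∃ τ ≤ T, Reaches G₁ f δ x₀ u τ x ∧ exitTime G₁ f δ x₀ u = τ := by
  obtain ⟨τ, hτT, hτ, hout⟩ := hx.exists_first
  exact ⟨τ, hτT, hτ, exitTime_eq_of_first hf hinv hu hτ hout⟩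

theorem freeTimeValue_eq_exitTimeValue (hf : LipschitzOnBoundedParts U f F)
    (hinv : StronglyInvariantFrom U G₁ f F x₀) :
    freeTimeValue U G₁ f g δ x₀ = exitTimeValue U G₁ f g δ x₀ := by
  refine le_antisymm (le_sInf ?_) (le_sInf ?_)
  · rintro _ ⟨u, hu, hlt, x, hx, rfl⟩
    obtain ⟨_, ⟨T, y, hy, rfl⟩, -⟩ := sInf_lt_iff.1 hlt
    obtain ⟨τ, -, hyτ, hτ⟩ := hy.exists_exitTime_eq hf hinv hu
    rw [hτ, ENNReal.coe_toReal] at hx ⊢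
    have heq : EqOn x y (Icc 0 (τ : ℝ)) := hf.eqOn (fun t ht => hu.mem t ht.1) hx
      (hinv u hu τ x hx) hyτ.1 (hinv u hu τ y hyτ.1)
    exact (freeTimeValue_le hu hyτ).trans_eq (runningCost_congr heq).symm
  · rintro _ ⟨u, hu, T, x, hx, rfl⟩
    obtain ⟨τ, hτT, hxτ, hτ⟩ := hx.exists_exitTime_eq hf hinv hu
    refine le_trans (sInf_le ⟨u, hu, hτ ▸ ENNReal.coe_lt_top, x, ?_, rfl⟩) ?_
    all_goals rw [hτ, ENNReal.coe_toReal]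
    exacts [hxτ.1, runningCost_mono (by exact_mod_cast hτT)]

theorem IsFreeTimeOptimal.isExitTimeOptimal (hu : IsFreeTimeOptimal U G₁ f g δ x₀ u)
    (hf : LipschitzOnBoundedParts U f F) (hinv : StronglyInvariantFrom U G₁ f F x₀) :
    IsExitTimeOptimal U G₁ f g δ x₀ u := by
  obtain ⟨hu, T, x, hx, hval⟩ := hu
  obtain ⟨τ, hτT, hxτ, hτ⟩ := hx.exists_exitTime_eq hf hinv hu
  have hcost : runningCost g x u τ = freeTimeValue U G₁ f g δ x₀ :=
    ((runningCost_mono (by exact_mod_cast hτT)).trans_eq hval).antisymm (freeTimeValue_le hu hxτ)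
  refine ⟨hu, hτ ▸ ENNReal.coe_lt_top, x, ?_, ?_⟩
  all_goals rw [hτ, ENNReal.coe_toReal]
  exacts [hxτ.1, hcost.trans (freeTimeValue_eq_exitTimeValue hf hinv)]

theorem exists_reaches_first_runningCost_lt {M : ℝ≥0∞} (hM : freeTimeValue U G₁ f g δ x₀ < M) :
    ∃ u, IsControl U u ∧ ∃ T x, Reaches G₁ f δ x₀ u T x ∧
      (∀ t ∈ Ico (0 : ℝ) T, δ < ‖x t‖) ∧ runningCost g x u T < M := by
  obtain ⟨_, ⟨u, hu, T, x, hx, rfl⟩, hlt⟩ := sInf_lt_iff.1 hM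
  obtain ⟨τ, hτT, hxτ, hout⟩ := hx.exists_first
  exact ⟨u, hu, τ, x, hxτ, hout, (runningCost_mono (by exact_mod_cast hτT)).trans_lt hlt⟩

theorem exists_minimizing_seq {M : ℝ≥0∞} (hM : freeTimeValue U G₁ f g δ x₀ < M) :
    ∃ (u : ℕ → ℝ → EuclideanSpace ℝ (Fin m)) (T : ℕ → ℝ≥0)
      (x : ℕ → ℝ → EuclideanSpace ℝ (Fin n)), (∀ k, IsControl U (u k)) ∧
      (∀ k, Reaches G₁ f δ x₀ (u k) (T k) (x k)) ∧
      (∀ k, ∀ t ∈ Ico (0 : ℝ) (T k), δ < ‖x k t‖) ∧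
      (∀ k, runningCost g (x k) (u k) (T k) ≤ M) ∧
      Tendsto (fun k => runningCost g (x k) (u k) (T k)) atTop
        (𝓝 (freeTimeValue U G₁ f g δ x₀)) := by
  obtain ⟨a, -, ha, hlim⟩ := exists_seq_strictAnti_tendsto' hM
  choose u hu T x hx hout hlt using fun k => exists_reaches_first_runningCost_lt (ha k).1
  exact ⟨u, T, x, hu, hx, hout, fun k => ((hlt k).trans (ha k).2).le,
    tendsto_of_tendsto_of_tendsto_of_le_of_le tendsto_const_nhds hlim
      (fun k => freeTimeValue_le (hu k) (hx k)) fun k => (hlt k).le⟩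

theorem exists_isFreeTimeOptimal (hU : IsCompact U) (hF : IsClosed F) (hFG : F ⊆ G₁)
    (hf : ContinuousOn f.uncurry (F ×ˢ U)) (hinv : StronglyInvariantFrom U G₁ f F x₀)
    (hg : ContinuousOn g.uncurry (F ×ˢ U)) (hg0 : ∀ x ∈ F, ∀ u ∈ U, 0 ≤ g x u)
    (hpos : ∃ c : ℝ, 0 < c ∧ ∀ x ∈ F, ∀ u ∈ U, δ < ‖x‖ → c ≤ g x u)
    (hgrow : ∃ C R : ℝ, 0 < C ∧ ∀ x ∈ F, ∀ u ∈ U, R ≤ ‖x‖ → C * ‖f x u‖ ≤ g x u)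
    (hconv : ∀ x ∈ F, Convex ℝ (augmentedVelocitySet U f g x))
    (hfin : freeTimeValue U G₁ f g δ x₀ < ∞) :
    ∃ u, IsFreeTimeOptimal U G₁ f g δ x₀ u := by
  obtain ⟨c, hc, hpos⟩ := hpos
  obtain ⟨C, R, hC, hgrow⟩ := hgrow
  obtain ⟨M, hVM, hM⟩ := exists_between hfin
  obtain ⟨u, T, x, hu, hx, hout, hle, hlim⟩ := exists_minimizing_seq hVM
  have hxF : ∀ k, MapsTo (x k) (Icc 0 (T k : ℝ)) F := fun k => hinv _ (hu k) _ _ (hx k).1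
  have hT : ∀ k, (T k : ℝ) ≤ M.toReal / c := fun k => by
    rw [le_div_iff₀' hc, ← ENNReal.ofReal_le_iff_le_toReal hM.ne]
    exact (ofReal_mul_le_runningCost (T k).2 fun t ht =>
      hpos _ (hxF k (Ico_subset_Icc_self ht)) _ ((hu k).mem t ht.1) (hout k t ht)).trans (hle k)
  set A := Metric.closedBall 0 (M.toReal / C + max ‖x₀‖ R) ∩ F
  have hxA : ∀ k, MapsTo (x k) (Icc 0 (T k : ℝ)) A := fun k t ht => by
    refine ⟨?_, hxF k ht⟩
    rw [mem_closedBall_zero_iff, ← sub_le_iff_le_add, le_div_iff₀' hC,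
      ← ENNReal.ofReal_le_iff_le_toReal hM.ne]
    exact ((hx k).1.ofReal_mul_norm_sub_le_runningCost hC.le (le_max_left _ R) (fun s hs hRs =>
      hgrow _ (hxF k hs) _ ((hu k).mem s hs.1) ((le_max_right _ _).trans hRs)) ht).trans (hle k)
  have hAF : A ⊆ F := inter_subset_right
  obtain ⟨w, hw, τ, hτ, y, hy, hend, hcost⟩ := exists_isTrajectory_of_tendsto_runningCost
    (hyperfilter ℕ) hU ((isCompact_closedBall _ _).inter_right hF) (hAF.trans hFG)
    (hf.mono (prod_mono hAF le_rfl)) (hg.mono (prod_mono hAF le_rfl))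
    (fun z hz => hg0 z (hAF hz)) (fun z hz => hconv z (hAF hz)) hu
    (fun k => ⟨(T k).2, hT k⟩) (fun k => (hx k).1) hxA (hlim.mono_left Nat.hyperfilter_le_atTop)
  lift τ to ℝ≥0 using hτ
  have hyδ : Reaches G₁ f δ x₀ w τ y :=
    ⟨hy, Metric.isClosed_closedBall.mem_of_tendsto hend (Eventually.of_forall fun k => (hx k).2)⟩
  exact ⟨w, hw, τ, y, hyδ, hcost.antisymm (freeTimeValue_le hw hyδ)⟩

theorem exists_reaches_of_mem_nullControllableRegion (hδ : 0 < δ)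
    (hx₀ : x₀ ∈ nullControllableRegion U G G₁ f) :
    ∃ u, IsControl U u ∧ ∃ T x, Reaches G₁ f δ x₀ u T x := by
  obtain ⟨-, u, hu, x, hx, hlim⟩ := hx₀
  obtain ⟨T, hT0, hT⟩ := ((eventually_ge_atTop 0).and (hlim.eventually_lt_const hδ)).exists
  lift T to ℝ≥0 using hT0
  exact ⟨u, hu, T, x, hx.mono Icc_subset_Ici_self, by simpa using hT.le⟩

end Optimality

theorem theorem3p11_general {n m : ℕ}
    {U : Set (EuclideanSpace ℝ (Fin m))} {G₁ F : Set (EuclideanSpace ℝ (Fin n))}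
    {f : EuclideanSpace ℝ (Fin n) → EuclideanSpace ℝ (Fin m) → EuclideanSpace ℝ (Fin n)}
    {g : EuclideanSpace ℝ (Fin n) → EuclideanSpace ℝ (Fin m) → ℝ}
    {x₀ : EuclideanSpace ℝ (Fin n)} {δ : ℝ}
    (hU : IsCompact U) (hF : IsClosed F) (hFG : F ⊆ G₁)
    (hf : ContinuousOn f.uncurry (F ×ˢ U)) (hlip : LipschitzOnBoundedParts U f F)
    (hinv : StronglyInvariantFrom U G₁ f F x₀)
    (hg : ContinuousOn g.uncurry (F ×ˢ U)) (hg0 : ∀ x ∈ F, ∀ u ∈ U, 0 ≤ g x u)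
    (hpos : ∃ c : ℝ, 0 < c ∧ ∀ x ∈ F, ∀ u ∈ U, δ < ‖x‖ → c ≤ g x u)
    (hgrow : ∃ C R : ℝ, 0 < C ∧ ∀ x ∈ F, ∀ u ∈ U, R ≤ ‖x‖ → C * ‖f x u‖ ≤ g x u)
    (hconv : ∀ x ∈ F, Convex ℝ (augmentedVelocitySet U f g x))
    (hreach : ∃ u, IsControl U u ∧ ∃ T x, Reaches G₁ f δ x₀ u T x) :
    freeTimeValue U G₁ f g δ x₀ = exitTimeValue U G₁ f g δ x₀ ∧
      freeTimeValue U G₁ f g δ x₀ < ∞ ∧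
      ∃ u, IsFreeTimeOptimal U G₁ f g δ x₀ u ∧ IsExitTimeOptimal U G₁ f g δ x₀ u := by
  have hfin := freeTimeValue_lt_top hU hg hinv hreach
  obtain ⟨u, hu⟩ :=
    exists_isFreeTimeOptimal hU hF hFG hf hinv hg hg0 hpos hgrow hconv hfin
  exact ⟨freeTimeValue_eq_exitTimeValue hlip hinv, hfin, u, hu, hu.isExitTimeOptimal hlip hinv⟩

theorem theorem3p11 {n m : ℕ}
    (U : Set (EuclideanSpace ℝ (Fin m))) (G G₁ : Set (EuclideanSpace ℝ (Fin n)))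
    (f : EuclideanSpace ℝ (Fin n) → EuclideanSpace ℝ (Fin m) → EuclideanSpace ℝ (Fin n))
    (g : EuclideanSpace ℝ (Fin n) → EuclideanSpace ℝ (Fin m) → ℝ)
    (r ubar : ℝ≥0) (β : ℝ≥0 → ℝ≥0 → ℝ≥0) (α₁ α₂ : ℝ≥0 → ℝ≥0)
    (hsys : SystemAssumption U G G₁ f)
    (hα₁ : IsClassKInfty α₁) (hα₂ : IsClassKInfty α₂)
    (hβ : ∀ ρ t : ℝ≥0, β ρ t ≤ α₂ (α₁ ρ * Real.toNNReal (Real.exp (-(t : ℝ)))))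
    (hctrl : (LocallyNullControllable U G G₁ f r ubar β ∧ CostBoundState U g r ubar α₂) ∨
      (SmallControlProperty U G G₁ f r β ∧ ubar = β r 0 ∧
        CostBoundStateControl U g r ubar α₂))
    (hcost : RunningCostAssumption U G f g r ubar)
    (hconv : ∀ x ∈ closure G,
      Convex ℝ {q : EuclideanSpace ℝ (Fin n) × ℝ | ∃ u ∈ U, q.1 = f x u ∧ g x u ≤ q.2})
    (δ : ℝ) (hδ : 0 < δ) (hδr : δ ≤ r)
    (x₀ : EuclideanSpace ℝ (Fin n))
    (hx₀ : x₀ ∈ nullControllableRegion U G G₁ f \ Metric.closedBall 0 δ) :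
    freeTimeValue U G₁ f g δ x₀ = exitTimeValue U G₁ f g δ x₀ ∧
      freeTimeValue U G₁ f g δ x₀ < ∞ ∧
      ∃ u, IsFreeTimeOptimal U G₁ f g δ x₀ u ∧ IsExitTimeOptimal U G₁ f g δ x₀ u := by
  obtain ⟨c, hc, hpos⟩ := hcost.pos_away δ hδ
  obtain ⟨C, hC, hgrow⟩ := hcost.growth
  exact theorem3p11_general hsys.isCompact_U isClosed_closure hsys.closure_subset
    (hsys.continuousOn_f.mono (prod_mono hsys.closure_subset le_rfl)) hsys.lipschitzOnBoundedParts
    (hsys.stronglyInvariantFrom hx₀.1.1) hcost.continuousOn_g hcost.nonneg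
    ⟨c, hc, fun x hx u hu hxδ => hpos x hx u hu hxδ.le⟩
    ⟨C, 2 * r, hC, fun x hx u hu hxr => hgrow x hx u hu (Or.inl hxr)⟩ hconv
    (exists_reaches_of_mem_nullControllableRegion hδ hx₀.1)
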